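/- Let $K$ be a number field with ring of integers $\mathcal O_K$. Let $X\subset\mathbb P^2_K$ be a geometrically integral plane curve of degree $\delta$, i.e. the closed subscheme of $\mathbb P^2_K$ defined by a nonzero homogeneous polynomial $f\in K[T_0,T_1,T_2]$ of degree $\delta$, and assume that $X\to\operatorname{Spec}K$ is geometrically integral. Let $\mathscr X\subset\mathbb P^2_{\mathcal O_K}$ be the Zariski closure of $X$; for a maximal ideal $\mathfrak p$ of $\mathcal O_K$ put $\mathbb F_{\mathfrak p}=\mathcal O_K/\mathfrak p$, $N(\mathfrak p)=\#\mathbb F_{\mathfrak p}$ and $\mathscr X_{\mathbb F_{\mathfrak p}}=\mathscr X\times_{\operatorname{Spec}\mathcal O_K}\operatorname{Spec}\mathbb F_{\mathfrak p}$, and let $$\mathcal Q(\mathscr X)=\{\mathfrak p\in\operatorname{Spm}\mathcal O_K \mid \mathscr X_{\mathbb F_{\mathfrak p}}\to\operatorname{Spec}\mathbb F_{\mathfrak p}\text{ is not geometrically integral}\}.$$ Let $h(X)=\frac1{[K:\mathbb Q]}\log\prod_{v}\max_{I}|a_I|_v^{[K_v:\mathbb Q_v]}$ be the naive height of $X$,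 where $v$ runs over all places of $K$ (with $|\cdot|_v$ extending the usual absolute value on $\mathbb Q$) and $a_I$ over the coefficients of $f$. Then $\mathcal Q(\mathscr X)$ is finite and $$\frac{1}{[K:\mathbb Q]}\sum_{\mathfrak p\in\mathcal Q(\mathscr X)}\log N(\mathfrak p)\le(\delta^2-1)\,h(X)+(3\delta^2-3)\log\delta.$$ -/

import Mathlib

open CategoryTheory CategoryTheory.Limits AlgebraicGeometry NumberField

universe u

namespace PlaneCurve

noncomputable section

section Plane

variable (R : Type u) [CommRing R]

/-- The standard grading by total degree on `R[T₀, T₁, T₂]`. -/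
abbrev grading : ℕ → Submodule R (MvPolynomial (Fin 3) R) :=
  MvPolynomial.homogeneousSubmodule (Fin 3) R

instance gradedAlgebraGrading : GradedAlgebra (grading R) :=
  MvPolynomial.gradedAlgebra

/-- The projective plane `ℙ²_R = Proj R[T₀, T₁, T₂]`. -/
abbrev Plane : Scheme.{u} := Proj (grading R)

/-- The structure morphism `ℙ²_R ⟶ Spec R`. -/
def Plane.toSpec : Plane R ⟶ Spec (.of R) :=
  Proj.toSpecZero (grading R) ≫
    Spec.map (CommRingCat.ofHom (algebraMap R (grading R 0)))

/-- The standard affine chart `D₊(Tⱼ)` of `ℙ²_R`. -/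
abbrev Plane.chart (j : Fin 3) : (Plane R).Opens :=
  Proj.basicOpen (grading R) (MvPolynomial.X j)

variable {R}

/-- For a form `f` of degree `d`, the regular function `f / Tⱼ ^ d` on the chart `D₊(Tⱼ)`. -/
def Plane.dehomogenize {d : ℕ} {f : MvPolynomial (Fin 3) R} (hf : f.IsHomogeneous d)
    (j : Fin 3) : Γ(Plane R, Plane.chart R j) :=
  (Proj.awayToSection (grading R) (MvPolynomial.X j)).hom
    (HomogeneousLocalization.Away.mk (grading R)
      (show MvPolynomial.X j ∈ grading R 1 from MvPolynomial.isHomogeneous_X R j) d f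
      (by simpa using hf))

/-- The morphism `i : X ⟶ ℙ²_R` is a closed immersion whose image is the closed subscheme
`V₊(f)` cut out by the form `f` of degree `d`: on each standard chart `D₊(Tⱼ)`, the ideal of
functions vanishing on `X` is generated by `f / Tⱼ ^ d`. -/
structure IsCutOutBy {X : Scheme.{u}} (i : X ⟶ Plane R) {d : ℕ}
    {f : MvPolynomial (Fin 3) R} (hf : f.IsHomogeneous d) : Prop where
  isClosedImmersion : IsClosedImmersion i
  ker_app_chart : ∀ j : Fin 3,
    RingHom.ker (i.app (Plane.chart R j)).hom = Ideal.span {Plane.dehomogenize hf j}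

end Plane

section BaseChange

variable (R S : Type u) [CommRing R] [CommRing S] [Algebra R S]

/-- The graded ring homomorphism `R[T₀, T₁, T₂] → S[T₀, T₁, T₂]` induced by `R → S`. -/
def gradedMap : GradedRingHom (grading R) (grading S) where
  __ := MvPolynomial.map (σ := Fin 3) (algebraMap R S)
  map_mem h := MvPolynomial.IsHomogeneous.map h (algebraMap R S)

lemma irrelevant_le_map_gradedMap :
    HomogeneousIdeal.irrelevant (grading S) ≤
      (HomogeneousIdeal.irrelevant (grading R)).map (gradedMap R S) := by
  refine (HomogeneousIdeal.irrelevant_le _).mpr fun n hn g hg ↦ ?_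
  change g ∈ (HomogeneousIdeal.irrelevant (grading R)).toIdeal.map (gradedMap R S)
  have hspan : g ∈ Ideal.span (MvPolynomial.X '' (Set.univ : Set (Fin 3))) := by
    rw [MvPolynomial.mem_ideal_span_X_image]
    intro m hm
    by_contra! h
    have hm0 : m = 0 := Finsupp.ext fun j ↦ h j (Set.mem_univ j)
    have := (MvPolynomial.mem_homogeneousSubmodule n g).mp hg (MvPolynomial.mem_support_iff.mp hm)
    simp [hm0] at this
    omega
  refine Ideal.span_le.mpr ?_ hspan
  rintro _ ⟨j, -, rfl⟩
  have hj : gradedMap R S (MvPolynomial.X j) = MvPolynomial.X j :=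
    MvPolynomial.map_X (algebraMap R S) j
  rw [← hj]
  exact Ideal.mem_map_of_mem _ (HomogeneousIdeal.mem_irrelevant_of_mem _ one_pos
    (MvPolynomial.isHomogeneous_X R j))

/-- The projection `ℙ²_S ⟶ ℙ²_R` induced by `R → S`. -/
def Plane.map : Plane S ⟶ Plane R :=
  Proj.map (gradedMap R S) (irrelevant_le_map_gradedMap R S)

end BaseChange

section Reduction

variable (K : Type u) [Field K] [NumberField K]

variable {K} {X : Scheme.{u}} (i : X ⟶ Plane K)

/-- The Zariski closure `𝒳` in `ℙ²_{𝓞 K}` of a subscheme `X` of `ℙ²_K`, that is, the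
scheme-theoretic image of `X ⟶ ℙ²_K ⟶ ℙ²_{𝓞 K}`. -/
abbrev zariskiClosure : Scheme.{u} :=
  (i ≫ Plane.map (𝓞 K) K).image

/-- The structure morphism `𝒳 ⟶ Spec 𝓞 K`. -/
def zariskiClosureToSpec : zariskiClosure i ⟶ Spec (.of (𝓞 K)) :=
  (i ≫ Plane.map (𝓞 K) K).imageι ≫ Plane.toSpec (𝓞 K)

/-- The fibre `𝒳 ×_{Spec 𝓞 K} Spec 𝔽_𝔭 ⟶ Spec 𝔽_𝔭`, where `𝔽_𝔭 = 𝓞 K ⧸ 𝔭`. -/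
def reduction (p : MaximalSpectrum (𝓞 K)) :
    pullback (zariskiClosureToSpec i)
      (Spec.map (CommRingCat.ofHom (Ideal.Quotient.mk p.asIdeal))) ⟶
      Spec (.of (𝓞 K ⧸ p.asIdeal)) :=
  pullback.snd _ _

/-- The set `𝒬(𝒳)` of the maximal ideals `𝔭` of `𝓞 K` such that `𝒳_{𝔽_𝔭} ⟶ Spec 𝔽_𝔭` is not
geometrically integral. -/
def badPrimes : Set (MaximalSpectrum (𝓞 K)) :=
  {p | ¬ GeometricallyIntegral (reduction i p)}

/-- The naive (absolute logarithmic) height of a polynomial `f` over the number field `K`: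
`1 / [K : ℚ]` times the logarithm of the product over all places `v` of
`max |a|_v ^ [K_v : ℚ_v]`, with `a` running through the coefficients of `f`. -/
def naiveHeight (f : MvPolynomial (Fin 3) K) : ℝ :=
  (Module.finrank ℚ K : ℝ)⁻¹ * Height.logHeight fun m : f.support ↦ f.coeff m

end Reduction

end

end PlaneCurve

/-! The argument is Ruppert's criterion combined with the product formula. Let `F` be a form of
degree `δ = d + 1` over an algebraically closed field. Consider the 1-forms `(G₀ dT₀ + G₁ dT₁ + G₂
dT₂) / F` with `Gᵢ` of degree `d` and `∑ Tᵢ Gᵢ = 0`. On the chart `T₀ = 1` such a form is `(r dT₁ +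
s dT₂) / F`, with `r = G₁`, `s = G₂`, and the existence of `G₀` becomes `T₀ ∣ T₁ r + T₂ s`.
Closedness is the linear condition `ruppert F r s = 0`.

In every characteristic a reducible `F` admits a nonzero closed form of this type
(`HasRuppertSolution.of_not_irreducible`): for `F = AB` a combination of `dA / A` and `dB / B`, and
for `A² ∣ F` some `d(L / A)`. In characteristic zero an irreducible `F` admits none
(`not_hasRuppertSolution`): the residue along the curve is a constant `c`, degrees force `r = c ∂₁F`
and `s = c ∂₂F`, and the condition at `T₀ = 0` gives `c = 0`.

The linear system has at most `δ² - 1` unknowns, and its matrix is linear in the coefficients of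
`F`. As `f` is irreducible over the algebraic closure of `K`, some maximal minor `Δ` is nonzero. At
a bad prime `𝔭`, rescale `f` to a polynomial `g` that is integral and nonzero modulo `𝔭`. By Gauss's
lemma the fibre of the closure is cut out by the reduction of `g`, so this reduction is
geometrically reducible (`IsCutOutBy.exists_not_irreducible`) and the minor of `g` lies in `𝔭`.

Let `H_v` be the maximum of the `|a_I|_v` and `N` the number of unknowns. Then `|Δ|_v ≤ (δ³ H_v)^N`
at infinite places (`map_det_ruppertMatrix_le`) and `|Δ|_v ≤ H_v^N` at finite ones, with an extra
factor `N(𝔭)⁻¹` at bad primes. The product formula for `Δ` gives the theorem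
(`finite_and_finsum_log_absNorm_le`). -/

open MvPolynomial in
lemma MvPolynomial.IsHomogeneous.eval₂_const_mul {σ R S : Type*} [CommSemiring R] [CommSemiring S] {n : ℕ}
    {f : MvPolynomial σ R} (hf : f.IsHomogeneous n) (φ : R →+* S) (a : S) (t : σ → S) :
    MvPolynomial.eval₂ φ (fun i ↦ a * t i) f = a ^ n * MvPolynomial.eval₂ φ t f := by
  classical
  rw [MvPolynomial.eval₂_eq, MvPolynomial.eval₂_eq, Finset.mul_sum]
  refine Finset.sum_congr rfl fun m hm ↦ ?_
  have hd : ∑ i ∈ m.support, m i = n := by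
    have := hf (mem_support_iff.mp hm)
    rwa [Finsupp.weight_apply, Finsupp.sum, Finset.sum_congr rfl (g := fun i ↦ m i) (by simp)]
      at this
  simp_rw [mul_pow, Finset.prod_mul_distrib, Finset.prod_pow_eq_pow_sum, hd]
  ring

/-! ### Coordinate rings of the standard charts of the plane. -/

namespace PlaneCurve

open MvPolynomial HomogeneousLocalization

noncomputable section

/-- The coordinate ring of the chart `D₊(Tⱼ)`. -/
abbrev Chart (R : Type u) [CommRing R] (j : Fin 3) : Type u :=
  Away (grading R) (X j : MvPolynomial (Fin 3) R)

namespace Chart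

variable {R S T : Type u} [CommRing R] [CommRing S] [CommRing T] {j : Fin 3}

/-- The fraction `f / Tⱼ ^ n` for a form `f` of degree `n`. -/
def frac (j : Fin 3) {n : ℕ} {f : MvPolynomial (Fin 3) R} (hf : f.IsHomogeneous n) : Chart R j :=
  Away.mk (grading R) (show X j ∈ grading R 1 from isHomogeneous_X R j) n f (by simpa using hf)

lemma val_frac {n : ℕ} {f : MvPolynomial (Fin 3) R} (hf : f.IsHomogeneous n) :
    (frac j hf).val = Localization.mk f
      (⟨X j ^ n, n, rfl⟩ : Submonoid.powers (X j : MvPolynomial (Fin 3) R)) := rfl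

lemma exists_frac (x : Chart R j) :
    ∃ (n : ℕ) (f : MvPolynomial (Fin 3) R) (hf : f.IsHomogeneous n), frac j hf = x := by
  obtain ⟨n, f, hf, rfl⟩ := Away.mk_surjective (grading R)
    (show X j ∈ grading R 1 from isHomogeneous_X R j) x
  exact ⟨n, f, by simpa using hf, rfl⟩

lemma frac_eq_frac_iff [IsDomain R] {n m : ℕ} {f g : MvPolynomial (Fin 3) R}
    (hf : f.IsHomogeneous n) (hg : g.IsHomogeneous m) :
    frac j hf = frac j hg ↔ X j ^ m * f = X j ^ n * g := by
  rw [HomogeneousLocalization.ext_iff_val, val_frac, val_frac, Localization.mk_eq_mk_iff,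
    Localization.r_iff_exists]
  constructor
  · rintro ⟨⟨_, k, rfl⟩, hc⟩
    exact mul_left_cancel₀ (pow_ne_zero k (X_ne_zero j)) hc
  · exact fun h ↦ ⟨1, by simpa using h⟩

lemma frac_mul_frac {n m : ℕ} {f g : MvPolynomial (Fin 3) R}
    (hf : f.IsHomogeneous n) (hg : g.IsHomogeneous m) :
    frac j hf * frac j hg = frac j (hf.mul hg) := by
  rw [HomogeneousLocalization.ext_iff_val, val_mul, val_frac, val_frac, val_frac,
    Localization.mk_mul]
  congr 1
  ext
  simp [pow_add]

lemma frac_zero {n : ℕ} : frac j (isHomogeneous_zero (Fin 3) R n) = 0 := by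
  rw [HomogeneousLocalization.ext_iff_val, val_frac, val_zero, Localization.mk_zero]

lemma frac_X_pow (n : ℕ) :
    frac j (isHomogeneous_X_pow (R := R) j n) = 1 := by
  rw [HomogeneousLocalization.ext_iff_val, val_frac, val_one]
  exact Localization.mk_self (⟨X j ^ n, n, rfl⟩ : Submonoid.powers (X j : MvPolynomial (Fin 3) R))

variable (R j) in
/-- The structure morphism of the chart. -/
def const : R →+* Chart R j :=
  (fromZeroRingHom (grading R) (Submonoid.powers (X j))).comp (algebraMap R (grading R 0))

variable (R j) in
/-- The coordinate function `Tₖ / Tⱼ`. -/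
def coord (k : Fin 3) : Chart R j := frac j (isHomogeneous_X R k)

lemma val_const (r : R) : (const R j r).val =
    algebraMap (MvPolynomial (Fin 3) R) (Localization (Submonoid.powers (X j))) (C r) := by
  have : (const R j r).val = Localization.mk (C r) 1 := rfl
  rw [this, Localization.mk_one_eq_algebraMap]

lemma coord_self : coord R j j = 1 := by
  have := frac_X_pow (R := R) (j := j) 1
  rw [← this, HomogeneousLocalization.ext_iff_val]
  simp [coord, val_frac]

/-- After multiplication by `Tⱼ ^ n`, homogeneity turns the evaluation at the `Tₖ / Tⱼ` into `f`
itself. Hence constants and coordinates generate the chart. -/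
lemma frac_eq_eval₂ {n : ℕ} {f : MvPolynomial (Fin 3) R} (hf : f.IsHomogeneous n) :
    frac j hf = eval₂ (const R j) (coord R j) f := by
  rw [HomogeneousLocalization.ext_iff_val, val_frac, Localization.mk_eq_mk', eq_comm,
    IsLocalization.eq_mk'_iff_mul_eq]
  have h1 : (eval₂ (const R j) (coord R j) f).val =
      eval₂ ((algebraMap (MvPolynomial (Fin 3) R) (Localization (Submonoid.powers (X j)))).comp C)
        (fun k ↦ (coord R j k).val) f := by
    rw [← HomogeneousLocalization.algebraMap_apply, ← coe_eval₂Hom, ← RingHom.comp_apply,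
      comp_eval₂Hom, coe_eval₂Hom]
    congr 1
  rw [h1, mul_comm, map_pow, ← hf.eval₂_const_mul]
  have h2 : (fun k ↦ algebraMap (MvPolynomial (Fin 3) R) (Localization (Submonoid.powers (X j)))
      (X j) * (coord R j k).val) =
      fun k ↦ algebraMap (MvPolynomial (Fin 3) R) _ (X k) := by
    ext k
    rw [coord, val_frac, Localization.mk_eq_mk', mul_comm]
    simp
  have h3 := eval₂_comp_left (algebraMap (MvPolynomial (Fin 3) R)
    (Localization (Submonoid.powers (X j : MvPolynomial (Fin 3) R)))) C X f
  rw [eval₂_eta] at h3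
  rw [h2]
  exact h3.symm

lemma hom_ext {φ ψ : Chart R j →+* T} (h : φ.comp (const R j) = ψ.comp (const R j))
    (h' : ∀ k, φ (coord R j k) = ψ (coord R j k)) : φ = ψ := by
  ext x
  obtain ⟨n, f, hf, rfl⟩ := exists_frac x
  rw [frac_eq_eval₂, ← coe_eval₂Hom, ← RingHom.comp_apply, ← RingHom.comp_apply,
    comp_eval₂Hom, comp_eval₂Hom, h]
  simp [h']

/-- Homomorphisms out of the chart `D₊(Tⱼ)`, by specifying the images of constants and of the
coordinate functions. -/
def lift (e : R →+* T) (t : Fin 3 → T) (ht : t j = 1) : Chart R j →+* T :=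
  (IsLocalization.Away.lift (S := Localization.Away (X j : MvPolynomial (Fin 3) R)) (X j)
    (g := eval₂Hom e t) (by simp [ht])).comp
    (algebraMap (Chart R j) (Localization.Away (X j : MvPolynomial (Fin 3) R)))

lemma lift_const (e : R →+* T) (t : Fin 3 → T) (ht : t j = 1) :
    (lift e t ht).comp (const R j) = e := by
  ext r
  simp only [lift, RingHom.comp_apply, HomogeneousLocalization.algebraMap_apply, val_const]
  simp

lemma lift_frac (e : R →+* T) (t : Fin 3 → T) (ht : t j = 1) {n : ℕ}
    {f : MvPolynomial (Fin 3) R} (hf : f.IsHomogeneous n) :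
    lift e t ht (frac j hf) = eval₂ e t f := by
  simp only [lift, RingHom.comp_apply, HomogeneousLocalization.algebraMap_apply, val_frac]
  rw [Localization.mk_eq_mk', IsLocalization.Away.lift, IsLocalization.lift_mk'_spec]
  simp [ht]

lemma lift_coord (e : R →+* T) (t : Fin 3 → T) (ht : t j = 1) (k : Fin 3) :
    lift e t ht (coord R j k) = t k := by
  rw [coord, lift_frac]; simp

variable (R S j) in
/-- The map on charts induced by `R → S`. -/
def map [Algebra R S] : Chart R j →+* Chart S j :=
  HomogeneousLocalization.map (gradedMap R S) (P := Submonoid.powers (X j))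
    (Q := Submonoid.powers (X j)) (by
      rintro _ ⟨n, rfl⟩
      exact ⟨n, by simp [gradedMap, ← GradedRingHom.coe_toRingHom]⟩)

lemma map_frac [Algebra R S] {n : ℕ} {f : MvPolynomial (Fin 3) R} (hf : f.IsHomogeneous n) :
    map R S j (frac j hf) = frac j (hf.map (algebraMap R S)) := by
  rw [HomogeneousLocalization.ext_iff_val, val_frac]
  change Localization.mk _ _ = _
  congr 1
  refine Subtype.ext ?_
  change MvPolynomial.map (algebraMap R S) (X j ^ n) = _
  simp

lemma map_coord [Algebra R S] (k : Fin 3) : map R S j (coord R j k) = coord S j k := by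
  rw [coord, map_frac, coord]
  congr 1
  simp

lemma map_comp_const [Algebra R S] :
    (map R S j).comp (const R j) = (const S j).comp (algebraMap R S) := by
  ext r
  have h1 (A : Type u) [CommRing A] (a : A) : const A j a = frac j (isHomogeneous_C (Fin 3) a) := by
    rw [frac_eq_eval₂, eval₂_C]
  rw [RingHom.comp_apply, RingHom.comp_apply, h1, h1, map_frac]
  congr 1
  simp

-- A homomorphism out of the chart over `S` amounts to a homomorphism out of `S` and values for the
-- coordinates, the `j`-th being `1`; these coordinates already come from `R`.
variable (R S j) in
lemma isPushout_map [Algebra R S] :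
    IsPushout (CommRingCat.ofHom (const R j)) (CommRingCat.ofHom (algebraMap R S))
      (CommRingCat.ofHom (map R S j)) (CommRingCat.ofHom (const S j)) := by
  refine ⟨⟨?_⟩, ⟨PushoutCocone.IsColimit.mk _ (fun s ↦ CommRingCat.ofHom
    (lift s.inr.hom (fun k ↦ s.inl.hom (coord R j k)) (by rw [coord_self, map_one]))) ?_ ?_ ?_⟩⟩
  · rw [← CommRingCat.ofHom_comp, ← CommRingCat.ofHom_comp, map_comp_const]
  · intro s
    ext1
    refine hom_ext ?_ fun k ↦ ?_
    · have := congr(($(s.condition)).hom)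
      simp only [CommRingCat.hom_comp, CommRingCat.hom_ofHom] at this ⊢
      rw [RingHom.comp_assoc, map_comp_const, ← RingHom.comp_assoc, lift_const, this]
    · simp [map_coord, lift_coord]
  · intro s
    ext1
    simp [lift_const]
  · intro s m h1 h2
    ext1
    refine hom_ext ?_ fun k ↦ ?_
    · simp only [CommRingCat.hom_ofHom, lift_const]
      rw [← h2]; simp
    · rw [CommRingCat.hom_ofHom, lift_coord, ← h1, ← map_coord (R := R) (S := S)]
      rfl

end Chart

end

end PlaneCurve

/-! ### Base change of closed subschemes of the plane, chart by chart. -/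

lemma CommRingCat.isPushout_quotient {A A' C : CommRingCat.{u}} (φ : A ⟶ A') (π : A ⟶ C)
    (hπ : Function.Surjective π.hom) :
    IsPushout π φ
      (CommRingCat.ofHom (RingHom.liftOfSurjective π.hom hπ
        ⟨(Ideal.Quotient.mk ((RingHom.ker π.hom).map φ.hom)).comp φ.hom, fun _ hx ↦
          Ideal.Quotient.eq_zero_iff_mem.mpr (Ideal.mem_map_of_mem _ hx)⟩))
      (CommRingCat.ofHom (Ideal.Quotient.mk ((RingHom.ker π.hom).map φ.hom))) := by
  have hcomm : π ≫ (CommRingCat.ofHom (RingHom.liftOfSurjective π.hom hπ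
        ⟨(Ideal.Quotient.mk ((RingHom.ker π.hom).map φ.hom)).comp φ.hom, fun x hx ↦
          Ideal.Quotient.eq_zero_iff_mem.mpr (Ideal.mem_map_of_mem _ hx)⟩)) =
      φ ≫ CommRingCat.ofHom (Ideal.Quotient.mk ((RingHom.ker π.hom).map φ.hom)) := by
    ext x
    simp [RingHom.liftOfRightInverse_comp_apply]
  refine ⟨⟨hcomm⟩, ⟨PushoutCocone.IsColimit.mk _ (fun s ↦ CommRingCat.ofHom
    (Ideal.Quotient.lift _ s.inr.hom fun a ha ↦ ?_)) ?_ ?_ ?_⟩⟩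
  · refine RingHom.mem_ker.mp (Ideal.map_le_iff_le_comap.mpr (fun x hx ↦ ?_) ha)
    have := congr(($(s.condition)).hom x)
    simp only [CommRingCat.hom_comp, RingHom.comp_apply] at this
    rw [Ideal.mem_comap, RingHom.mem_ker, ← this, RingHom.mem_ker.mp hx, map_zero]
  · intro s
    have : Epi π := ConcreteCategory.epi_of_surjective π hπ
    rw [← cancel_epi π, reassoc_of% hcomm]
    refine Eq.trans ?_ s.condition.symm
    congr 1
  · intro s
    ext x
    simp
  · intro s m h1 h2
    ext x
    simp [← h2]

namespace PlaneCurve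

open MvPolynomial HomogeneousLocalization

noncomputable section

variable {R : Type u} [CommRing R]

lemma X_mem_grading (j : Fin 3) : X j ∈ grading R 1 := isHomogeneous_X R j

variable (R) in
/-- The open immersion of the chart `D₊(Tⱼ)` into the plane. -/
def chartι (j : Fin 3) : Spec (.of (Chart R j)) ⟶ Plane R :=
  Proj.awayι (grading R) (X j) (X_mem_grading j) one_pos

lemma chartι_toSpec (j : Fin 3) :
    chartι R j ≫ Plane.toSpec R = Spec.map (CommRingCat.ofHom (Chart.const R j)) := by
  rw [chartι, Plane.toSpec, Proj.awayι_toSpecZero_assoc, ← Spec.map_comp]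
  rfl

lemma iSup_chart : ⨆ j, Plane.chart R j = ⊤ := by
  refine Proj.iSup_basicOpen_eq_top _ _ ((HomogeneousIdeal.toIdeal_irrelevant_le _).mpr
    fun n hn g hg ↦ ?_)
  change g ∈ Ideal.span (Set.range X)
  rw [← Set.image_univ, MvPolynomial.mem_ideal_span_X_image]
  intro m hm
  by_contra! h
  have hm0 : m = 0 := Finsupp.ext fun j ↦ h j (Set.mem_univ j)
  have := (MvPolynomial.mem_homogeneousSubmodule n g).mp hg (MvPolynomial.mem_support_iff.mp hm)
  simp [hm0] at this
  omega

lemma isAffineOpen_chart (j : Fin 3) : IsAffineOpen (Plane.chart R j) :=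
  Proj.isAffineOpen_basicOpen _ _ (X_mem_grading j) one_pos

lemma fromSpec_chart (j : Fin 3) :
    (isAffineOpen_chart (R := R) j).fromSpec =
      Spec.map (Proj.awayToSection (grading R) (X j)) ≫ chartι R j := by
  rw [← cancel_epi (isAffineOpen_chart (R := R) j).isoSpec.hom,
    IsAffineOpen.isoSpec_hom_fromSpec, chartι, Proj.awayι, IsAffineOpen.isoSpec_hom,
    ← Category.assoc]
  change _ = Proj.basicOpenToSpec (grading R) (X j) ≫ _
  rw [← Proj.basicOpenIsoSpec_hom (grading R) (X j) (X_mem_grading j) one_pos,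
    Iso.hom_inv_id_assoc]

section BaseChange

variable {Z : Scheme.{u}} (ι : Z ⟶ Plane R) [IsClosedImmersion ι]

/-- The restriction of functions on the chart `D₊(Tⱼ)` to a closed subscheme. -/
def restrictChart (j : Fin 3) : CommRingCat.of (Chart R j) ⟶ Γ(Z, ι ⁻¹ᵁ Plane.chart R j) :=
  Proj.awayToSection (grading R) (X j) ≫ ι.app (Plane.chart R j)

lemma awayToSection_bijective (j : Fin 3) :
    Function.Bijective (Proj.awayToSection (grading R) (X j)).hom :=
  ConcreteCategory.bijective_of_isIso
    (Proj.basicOpenIsoAway (grading R) (X j) (X_mem_grading j) one_pos).hom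

lemma restrictChart_surjective (j : Fin 3) : Function.Surjective (restrictChart ι j).hom :=
  (ι.app_surjective _ (isAffineOpen_chart j)).comp (awayToSection_bijective j).2

lemma fromSpec_comp (j : Fin 3) :
    ((isAffineOpen_chart (R := R) j).preimage ι).fromSpec ≫ ι =
      Spec.map (restrictChart ι j) ≫ chartι R j := by
  rw [restrictChart, Spec.map_comp, Category.assoc, ← fromSpec_chart,
    ← IsAffineOpen.SpecMap_appLE_fromSpec ι (isAffineOpen_chart j) _ le_rfl,
    Scheme.Hom.app_eq_appLE]

variable (E : Type u) [CommRing E] [Algebra R E]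

/-- The ideal of the chart `D₊(Tⱼ)` of `ℙ²_E` defining the base change of a closed subscheme
of `ℙ²_R`. -/
def chartIdeal (j : Fin 3) : Ideal (Chart E j) :=
  (RingHom.ker (restrictChart ι j).hom).map (Chart.map R E j)

variable {E} {Y : Scheme.{u}} {fst : Y ⟶ Z} {snd : Y ⟶ Spec (.of E)}

/-- Over `D₊(Tⱼ)` the subscheme is the spectrum of a quotient of the chart ring. Its base change is
computed by pasting the pushout squares for extension of scalars and for passage to the quotient by
the extended ideal. -/
lemma exists_chart_of_isPullback
    (h : IsPullback fst snd (ι ≫ Plane.toSpec R)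
      (Spec.map (CommRingCat.ofHom (algebraMap R E)))) (j : Fin 3) :
    ∃ e : Spec (.of (Chart E j ⧸ chartIdeal ι E j)) ⟶ Y, ∃ _ : IsOpenImmersion e,
      e.opensRange = fst ⁻¹ᵁ ι ⁻¹ᵁ Plane.chart R j ∧
      e ≫ fst ≫ ι = Spec.map (CommRingCat.ofHom
        ((Ideal.Quotient.mk (chartIdeal ι E j)).comp (Chart.map R E j))) ≫ chartι R j := by
  have hq := CommRingCat.isPushout_quotient (CommRingCat.ofHom (Chart.map R E j))
    (restrictChart ι j) (restrictChart_surjective ι j)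
  have hp := isPullback_SpecMap_of_isPushout _ _ _ _
    ((Chart.isPushout_map R E j).paste_horiz hq)
  have hU := (isAffineOpen_chart (R := R) j).preimage ι
  have hbot : hU.fromSpec ≫ ι ≫ Plane.toSpec R =
      Spec.map (CommRingCat.ofHom (Chart.const R j) ≫ restrictChart ι j) := by
    rw [← Category.assoc, fromSpec_comp, Category.assoc, chartι_toSpec, ← Spec.map_comp]
  let e := h.lift (Spec.map _ ≫ hU.fromSpec) (Spec.map _)
    (by rw [Category.assoc, hbot]; exact hp.w)
  have he1 : e ≫ fst = _ := h.lift_fst _ _ _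
  have he2 : e ≫ snd = _ := h.lift_snd _ _ _
  -- Cancellation of cartesian squares: the outer rectangle is `hp` and one of its two squares is
  -- `h`.
  have hpb : IsPullback e _ fst hU.fromSpec :=
    IsPullback.of_right (by rw [he2, hbot]; exact hp.flip) he1 h.flip
  have hopen : IsOpenImmersion e := MorphismProperty.of_isPullback hpb.flip inferInstance
  have hrange : e.opensRange = fst ⁻¹ᵁ ι ⁻¹ᵁ Plane.chart R j := by
    have he : e = hpb.isoPullback.hom ≫ pullback.fst fst hU.fromSpec := by simp
    rw! [he]
    rw [Scheme.Hom.opensRange_comp_of_isIso, Scheme.Hom.opensRange_pullbackFst,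
      hU.opensRange_fromSpec]
  have hcomp : e ≫ fst ≫ ι = Spec.map (CommRingCat.ofHom (Chart.map R E j) ≫ CommRingCat.ofHom
      (Ideal.Quotient.mk ((RingHom.ker (restrictChart ι j).hom).map
        (CommRingCat.ofHom (Chart.map R E j)).hom))) ≫ chartι R j := by
    rw [← Category.assoc, he1, Category.assoc, fromSpec_comp, ← Category.assoc, ← Spec.map_comp,
      hq.w]
  exact ⟨e, hopen, hrange, hcomp⟩

end BaseChange

end

end PlaneCurve

/-! ### Factorization of forms and of their dehomogenizations. -/

namespace MvPolynomial

section Factors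

variable {σ R : Type*} [CommRing R]

variable (σ R) in
/-- The homomorphism sending a form `f` of degree `n` to `t ^ n * f`. -/
noncomputable def gradingHom : MvPolynomial σ R →+* Polynomial (MvPolynomial σ R) :=
  eval₂Hom (Polynomial.C.comp C) fun i ↦ Polynomial.X * Polynomial.C (X i)

lemma IsHomogeneous.gradingHom_apply {n : ℕ} {f : MvPolynomial σ R} (hf : f.IsHomogeneous n) :
    gradingHom σ R f = Polynomial.X ^ n * Polynomial.C f := by
  rw [gradingHom, coe_eval₂Hom, hf.eval₂_const_mul]
  congr 1
  have := eval₂_comp_left Polynomial.C C X f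
  rw [eval₂_eta] at this
  exact this.symm

lemma coeff_gradingHom (f : MvPolynomial σ R) (n : ℕ) :
    (gradingHom σ R f).coeff n = homogeneousComponent n f := by
  conv_lhs => rw [← sum_homogeneousComponent f, map_sum, Polynomial.finsetSum_coeff]
  simp_rw [(homogeneousComponent_isHomogeneous _ f).gradingHom_apply, mul_comm (Polynomial.X ^ _),
    Polynomial.coeff_C_mul_X_pow]
  rw [Finset.sum_ite_eq]
  split_ifs with h
  · rfl
  · rw [homogeneousComponent_eq_zero]
    simpa using h

lemma gradingHom_ne_zero {f : MvPolynomial σ R} (hf : f ≠ 0) : gradingHom σ R f ≠ 0 := by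
  intro h
  apply hf
  rw [← sum_homogeneousComponent f]
  refine Finset.sum_eq_zero fun i _ ↦ ?_
  rw [← coeff_gradingHom, h, Polynomial.coeff_zero]

lemma isHomogeneous_natDegree_of_natTrailingDegree_eq {f : MvPolynomial σ R}
    (h : (gradingHom σ R f).natTrailingDegree = (gradingHom σ R f).natDegree) :
    f.IsHomogeneous (gradingHom σ R f).natDegree := by
  set m := (gradingHom σ R f).natDegree with hm
  have h0 : ∀ i, i ≠ m → homogeneousComponent i f = 0 := fun i hi ↦ by
    rw [← coeff_gradingHom]
    rcases lt_or_gt_of_ne hi with hi | hi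
    · exact Polynomial.coeff_eq_zero_of_lt_natTrailingDegree (by omega)
    · exact Polynomial.coeff_eq_zero_of_natDegree_lt hi
  have hf : f = homogeneousComponent m f := by
    conv_lhs => rw [← sum_homogeneousComponent f]
    by_cases hmem : m ∈ Finset.range (f.totalDegree + 1)
    · exact Finset.sum_eq_single_of_mem m hmem fun i _ hi ↦ h0 i hi
    · rw [homogeneousComponent_eq_zero m f (by simpa using hmem)]
      exact Finset.sum_eq_zero fun i hi ↦ h0 i fun h ↦ hmem (h ▸ hi)
  rw [hf]
  exact homogeneousComponent_isHomogeneous m f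

/-- The factors of a nonzero form are forms. -/
lemma IsHomogeneous.exists_of_mul [IsDomain R] {n : ℕ} {f g : MvPolynomial σ R}
    (h : (f * g).IsHomogeneous n) (hfg : f * g ≠ 0) :
    ∃ a b, a + b = n ∧ f.IsHomogeneous a ∧ g.IsHomogeneous b := by
  have hf := gradingHom_ne_zero (left_ne_zero_of_mul hfg)
  have hg := gradingHom_ne_zero (right_ne_zero_of_mul hfg)
  -- The product is a single term in the auxiliary variable. Lowest and highest degrees are
  -- additive, so they must agree for each factor as well.
  have hm : gradingHom σ R f * gradingHom σ R g = Polynomial.C (f * g) * Polynomial.X ^ n := by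
    rw [← map_mul, h.gradingHom_apply, mul_comm]
  have h1 := Polynomial.natDegree_mul hf hg
  have h2 := Polynomial.natTrailingDegree_mul hf hg
  rw [hm, Polynomial.natDegree_C_mul_X_pow _ _ hfg] at h1
  rw [hm, Polynomial.C_mul_X_pow_eq_monomial, Polynomial.natTrailingDegree_monomial hfg] at h2
  have h3 := Polynomial.natTrailingDegree_le_natDegree (gradingHom σ R f)
  have h4 := Polynomial.natTrailingDegree_le_natDegree (gradingHom σ R g)
  exact ⟨_, _, h1.symm, isHomogeneous_natDegree_of_natTrailingDegree_eq (by omega),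
    isHomogeneous_natDegree_of_natTrailingDegree_eq (by omega)⟩

end Factors

end MvPolynomial

namespace PlaneCurve

open MvPolynomial HomogeneousLocalization

noncomputable section

namespace Chart

variable {E : Type u} [Field E] {d : ℕ} {F : MvPolynomial (Fin 3) E} (hF : F.IsHomogeneous d)
  {j : Fin 3}

lemma frac_dvd_frac {n : ℕ} {g : MvPolynomial (Fin 3) E} (hg : g.IsHomogeneous n) (h : F ∣ g) :
    frac j hF ∣ frac j hg := by
  obtain ⟨c, rfl⟩ := h
  by_cases h0 : F * c = 0
  · have : frac j hg = 0 := by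
      rw [← frac_zero (n := n)]
      congr 1
    simp [this]
  · obtain ⟨a, b, hab, ha, hb⟩ := hg.exists_of_mul h0
    obtain rfl := hF.inj_right ha (left_ne_zero_of_mul h0)
    refine ⟨frac j hb, ?_⟩
    rw [frac_mul_frac, frac_eq_frac_iff, hab]

lemma exists_dvd_X_pow_mul_of_frac_dvd_frac {n : ℕ} {g : MvPolynomial (Fin 3) E}
    (hg : g.IsHomogeneous n) (h : frac j hF ∣ frac j hg) : ∃ k, F ∣ X j ^ k * g := by
  obtain ⟨c, hc⟩ := h
  obtain ⟨m, c, hm, rfl⟩ := exists_frac c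
  rw [frac_mul_frac, frac_eq_frac_iff] at hc
  exact ⟨d + m, X j ^ n * c, by rw [hc]; ring⟩

lemma isUnit_frac_of_dvd_X (h : F ∣ X j) : IsUnit (frac j hF) := by
  rw [isUnit_iff_dvd_one, ← coord_self]
  exact frac_dvd_frac hF _ h

lemma exists_dvd_X_pow_of_isUnit_frac (h : IsUnit (frac j hF)) : ∃ k, F ∣ X j ^ k := by
  obtain ⟨k, hk⟩ := exists_dvd_X_pow_mul_of_frac_dvd_frac hF (isHomogeneous_X_pow (R := E) j 0)
    (h.dvd)
  exact ⟨k, by simpa using hk⟩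

lemma prime_frac (h : Prime F) (hX : ¬ F ∣ X j) : Prime (frac j hF) := by
  refine ⟨fun h0 ↦ ?_, fun hu ↦ ?_, fun x y hxy ↦ ?_⟩
  · rw [← frac_zero (n := 0), frac_eq_frac_iff] at h0
    simp [h.ne_zero] at h0
  · obtain ⟨k, hk⟩ := exists_dvd_X_pow_of_isUnit_frac hF hu
    exact hX (h.dvd_of_dvd_pow hk)
  · obtain ⟨n, f, hf, rfl⟩ := exists_frac x
    obtain ⟨m, g, hg, rfl⟩ := exists_frac y
    rw [frac_mul_frac] at hxy
    obtain ⟨k, hk⟩ := exists_dvd_X_pow_mul_of_frac_dvd_frac hF _ hxy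
    rcases h.dvd_or_dvd hk with hk | hk
    · exact absurd (h.dvd_of_dvd_pow hk) hX
    · exact (h.dvd_or_dvd hk).imp (frac_dvd_frac hF hf) (frac_dvd_frac hF hg)

lemma not_frac_dvd_coord (h : Prime F) (hX : ¬ F ∣ X j) {k : Fin 3} (hk : ¬ F ∣ X k) :
    ¬ frac j hF ∣ coord E j k := by
  intro hd
  obtain ⟨n, hn⟩ := exists_dvd_X_pow_mul_of_frac_dvd_frac hF _ hd
  rcases h.dvd_or_dvd hn with hn | hn
  exacts [hX (h.dvd_of_dvd_pow hn), hk hn]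

end Chart

lemma isUnit_of_dvd_X_pow {σ E : Type*} [Field E] {G : MvPolynomial σ E} {j k : σ} (hjk : j ≠ k)
    {a b : ℕ} (ha : G ∣ X j ^ a) (hb : G ∣ X k ^ b) : IsUnit G := by
  obtain ⟨m, -, hm⟩ := (dvd_prime_pow (X_prime (R := E) (i := j)) a).mp ha
  obtain rfl | hm0 := eq_or_ne m 0
  · rw [pow_zero] at hm
    exact hm.symm.isUnit isUnit_one
  · have h1 : (X j : MvPolynomial σ E) ∣ X k :=
      (X_prime (R := E) (i := j)).dvd_of_dvd_pow
        (((dvd_pow_self _ hm0).trans hm.symm.dvd).trans hb)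
    rw [X_dvd_X] at h1
    exact absurd h1 (by simp [hjk])

/-- A form is irreducible if its dehomogenizations generate prime ideals or the unit ideal. -/
lemma irreducible_of_isDomain_chart {E : Type u} [Field E] {d : ℕ} {F : MvPolynomial (Fin 3) E}
    (hF : F.IsHomogeneous d) (hF0 : F ≠ 0) (hd : d ≠ 0)
    (h : ∀ j, ¬ IsUnit (Chart.frac j hF) →
      IsDomain (Chart E j ⧸ Ideal.span {Chart.frac j hF})) : Irreducible F := by
  refine ⟨fun hu ↦ hd ?_, fun A B hAB ↦ ?_⟩
  · obtain ⟨c, hc, rfl⟩ := (MvPolynomial.isUnit_iff_eq_C_of_isReduced).mp hu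
    exact hF.inj_right (isHomogeneous_C _ _) hF0
  by_contra! hn
  obtain ⟨a, b, hab, hA, hB⟩ := (hAB ▸ hF).exists_of_mul (hAB ▸ hF0)
  obtain ⟨hA0, hB0⟩ := mul_ne_zero_iff.mp (hAB ▸ hF0)
  -- On a chart where the dehomogenization of `F = AB` generates a prime ideal, it divides that of
  -- `A` or of `B`; cancelling, the other factor divides a power of `Tⱼ`. The Boolean records which
  -- one.
  have key : ∀ j : Fin 3, ∃ c : Bool, ∃ k, (if c then A else B) ∣ X j ^ k := by
    intro j
    by_cases hu : IsUnit (Chart.frac j hF)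
    · obtain ⟨k, hk⟩ := Chart.exists_dvd_X_pow_of_isUnit_frac hF hu
      exact ⟨true, k, by simpa using (Dvd.intro _ hAB.symm).trans hk⟩
    · have := h j hu
      have hp := (Ideal.Quotient.isDomain_iff_prime _).mp this
      have hm : Chart.frac j hA * Chart.frac j hB ∈ Ideal.span {Chart.frac j hF} := by
        rw [Chart.frac_mul_frac, Ideal.mem_span_singleton]
        exact Chart.frac_dvd_frac hF _ hAB.dvd
      rcases hp.mem_or_mem hm with hm | hm <;> rw [Ideal.mem_span_singleton] at hm <;>
        obtain ⟨k, hk⟩ := Chart.exists_dvd_X_pow_mul_of_frac_dvd_frac hF _ hm <;>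
        rw [hAB] at hk
      · rw [mul_comm] at hk
        exact ⟨false, k, by simpa using (mul_dvd_mul_iff_right hA0).mp hk⟩
      · exact ⟨true, k, by simpa using (mul_dvd_mul_iff_right hB0).mp hk⟩
  choose c k hk using key
  -- There are three charts but two factors, so one factor divides powers of two different variables
  -- and is a unit.
  obtain ⟨i, j, hij, hc⟩ := Fintype.exists_ne_map_eq_of_card_lt c (by simp)
  have hi := hk i
  rw [hc] at hi
  have := isUnit_of_dvd_X_pow hij hi (hk j)
  split_ifs at this
  exacts [hn.1 this, hn.2 this]


end

end PlaneCurve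

/-! ### Integrality of the curve and irreducibility of its equation. -/

namespace PlaneCurve

open MvPolynomial HomogeneousLocalization

noncomputable section

section Integral

lemma iSup_preimage_chart {R : Type u} [CommRing R] {Z Y : Scheme.{u}} (ι : Z ⟶ Plane R)
    {fst : Y ⟶ Z} : ⨆ j, fst ⁻¹ᵁ ι ⁻¹ᵁ Plane.chart R j = ⊤ := by
  rw [← Scheme.Hom.preimage_iSup, ← Scheme.Hom.preimage_iSup, iSup_chart]
  rfl

variable {R E : Type u} [CommRing R] [Field E] [Algebra R E]
variable {Z : Scheme.{u}} (ι : Z ⟶ Plane R) [IsClosedImmersion ι]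
variable {Y : Scheme.{u}} {fst : Y ⟶ Z} {snd : Y ⟶ Spec (.of E)}
variable {d : ℕ} {F : MvPolynomial (Fin 3) E} (hF : F.IsHomogeneous d)

lemma irreducible_of_isIntegral (h : IsPullback fst snd (ι ≫ Plane.toSpec R)
      (Spec.map (CommRingCat.ofHom (algebraMap R E))))
    (hι : ∀ j, chartIdeal ι E j = Ideal.span {Chart.frac j hF}) (hF0 : F ≠ 0)
    [IsIntegral Y] : Irreducible F := by
  refine irreducible_of_isDomain_chart hF hF0 ?_ fun j hj ↦ ?_
  · rintro rfl
    obtain ⟨y⟩ : Nonempty Y := inferInstance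
    have hy : y ∈ ⨆ j, fst ⁻¹ᵁ ι ⁻¹ᵁ Plane.chart R j := by
      rw [iSup_preimage_chart]; trivial
    obtain ⟨j, hj⟩ := TopologicalSpace.Opens.mem_iSup.mp hy
    obtain ⟨e, he, hr, -⟩ := exists_chart_of_isPullback ι h j
    rw [← hr] at hj
    obtain ⟨x, -⟩ := hj
    have hu : IsUnit F := by
      rw [← totalDegree_zero_iff_isHomogeneous, totalDegree_eq_zero_iff_eq_C] at hF
      rw [hF] at hF0 ⊢
      refine IsUnit.map C (isUnit_iff_ne_zero.mpr fun h0 ↦ hF0 (by rw [h0, C_0]))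
    have htop : chartIdeal ι E j = ⊤ := by
      rw [hι, Ideal.span_singleton_eq_top]
      exact Chart.isUnit_frac_of_dvd_X hF hu.dvd
    have := Ideal.Quotient.subsingleton_iff.mpr htop
    exact (PrimeSpectrum.isEmpty_iff_subsingleton.mpr this).false x
  · obtain ⟨e, he, -⟩ := exists_chart_of_isPullback ι h j
    have hnt : Nontrivial (Chart E j ⧸ chartIdeal ι E j) := by
      rwa [Ideal.Quotient.nontrivial_iff, hι, Ne, Ideal.span_singleton_eq_top]
    have : Nonempty (Spec (.of (Chart E j ⧸ chartIdeal ι E j))) :=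
      inferInstanceAs (Nonempty (PrimeSpectrum (Chart E j ⧸ chartIdeal ι E j)))
    have := isIntegral_of_isOpenImmersion e
    rw [← hι]
    exact (affine_isIntegral_iff _).mp this

/-- The charts with `F ∣ Tⱼ` are empty and the others are spectra of domains. Any two of the latter
meet, because `F` does not divide `Tₖ` and so the generic point of one chart lies in the other. -/
lemma isIntegral_of_irreducible (h : IsPullback fst snd (ι ≫ Plane.toSpec R)
      (Spec.map (CommRingCat.ofHom (algebraMap R E))))
    (hι : ∀ j, chartIdeal ι E j = Ideal.span {Chart.frac j hF}) (hirr : Irreducible F) :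
    IsIntegral Y := by
  have hFp := hirr.prime
  choose e he hr hc using exists_chart_of_isPullback ι h
  have hdom (j : {j : Fin 3 // ¬ F ∣ X j}) : IsDomain (Chart E j.1 ⧸ chartIdeal ι E j) := by
    have hp := Chart.prime_frac hF hFp j.2
    rw [Ideal.Quotient.isDomain_iff_prime, hι, Ideal.span_singleton_prime hp.ne_zero]
    exact hp
  have hint (j : {j : Fin 3 // ¬ F ∣ X j}) :
      IsIntegral (Spec (.of (Chart E j.1 ⧸ chartIdeal ι E j))) :=
    (affine_isIntegral_iff _).mpr (hdom j)
  have hcov : TopologicalSpace.IsOpenCover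
      fun j : {j : Fin 3 // ¬ F ∣ X j} ↦ (e j).opensRange := by
    refine top_le_iff.mp ?_
    rw [← iSup_preimage_chart (fst := fst) ι]
    refine iSup_le fun j ↦ ?_
    by_cases hj : F ∣ X j
    · have htop : chartIdeal ι E j = ⊤ := by
        rw [hι, Ideal.span_singleton_eq_top]
        exact Chart.isUnit_frac_of_dvd_X hF hj
      have := Ideal.Quotient.subsingleton_iff.mpr htop
      rw [← hr]
      rintro _ ⟨x, -⟩
      exact ((PrimeSpectrum.isEmpty_iff_subsingleton.mpr this).false x).elim
    · rw [← hr]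
      exact le_iSup (fun j : {j : Fin 3 // ¬ F ∣ X j} ↦ (e j).opensRange) ⟨j, hj⟩
  have hiso (j : {j : Fin 3 // ¬ F ∣ X j}) : IsIntegral (e j).opensRange.toScheme :=
    have : Nonempty (e j).opensRange.toScheme :=
      ⟨(e j).isoOpensRange.hom (Classical.arbitrary _)⟩
    isIntegral_of_isOpenImmersion (e j).isoOpensRange.inv
  -- An irreducible form cannot divide both `T₀` and `T₁`, so some chart is nonempty.
  have hne : Nonempty {j : Fin 3 // ¬ F ∣ X j} := by
    by_contra! hemp
    have hall (j : Fin 3) : F ∣ X j := not_not.mp fun hj ↦ hemp.false ⟨j, hj⟩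
    exact hFp.not_isUnit (isUnit_of_dvd_X_pow (j := (0 : Fin 3)) (k := 1) (a := 1) (b := 1)
      (by decide) (by simpa using hall 0) (by simpa using hall 1))
  have hpre : PreirreducibleSpace Y := by
    refine PreirreducibleSpace.of_isOpenCover (fun j k hjk hd ↦ ?_) hcov fun j ↦ ?_
    · let x : Spec (.of (Chart E j.1 ⧸ chartIdeal ι E j)) :=
        (⊥ : PrimeSpectrum (Chart E j.1 ⧸ chartIdeal ι E j))
      have hx : e j x ∈ (e k).opensRange := by
        rw [hr]
        change (e j ≫ fst ≫ ι) x ∈ Plane.chart R k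
        rw [hc]
        change (Spec.map _) x ∈ chartι R j ⁻¹ᵁ Plane.chart R k
        rw [chartι, Proj.awayι_preimage_basicOpen (grading R) (X_mem_grading j.1) one_pos
          (X_mem_grading k.1) one_pos]
        have hel : Away.isLocalizationElem (X_mem_grading (R := R) j.1) (X_mem_grading k.1) =
            Chart.coord R j.1 k := by
          rw [HomogeneousLocalization.ext_iff_val]
          simp [Chart.coord, Chart.val_frac]
        rw [hel]
        change ¬ (Ideal.Quotient.mk (chartIdeal ι E j.1)) (Chart.map R E j.1 (Chart.coord R j.1 k))
          ∈ (⊥ : Ideal _)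
        rw [Chart.map_coord, Ideal.mem_bot, Ideal.Quotient.eq_zero_iff_mem, hι,
          Ideal.mem_span_singleton]
        exact Chart.not_frac_dvd_coord hF hFp j.2 k.2
      have : e j x ∈ (⊥ : Y.Opens) := disjoint_iff.mp hd ▸ ⟨⟨x, rfl⟩, hx⟩
      exact this
    · have : IsIntegral (e j).opensRange.toScheme := hiso j
      exact inferInstanceAs (PreirreducibleSpace (e j).opensRange.toScheme)
  have : IrreducibleSpace Y := ⟨⟨e hne.some (Classical.arbitrary _)⟩⟩
  have : IsReduced Y := by
    have hred (j) : IsReduced ((Y.openCoverOfIsOpenCover _ hcov).X j) :=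
      have := hiso j
      inferInstanceAs (IsReduced (e j.1).opensRange.toScheme)
    exact IsReduced.of_openCover _ (Y.openCoverOfIsOpenCover _ hcov)
  exact isIntegral_of_irreducibleSpace_of_isReduced Y

end Integral

end

end PlaneCurve

/-! ### Gauss's lemma at one prime of a Dedekind domain. -/

/-- Finitely many elements of the fraction field of a Dedekind domain, not all zero, can be scaled
so as to become integral and not all divisible by a given prime ideal. -/
lemma IsDedekindDomain.exists_smul_notMem {R K ι : Type*} [CommRing R] [IsDedekindDomain R]
    [Field K] [Algebra R K] [IsFractionRing R K] (p : Ideal R) (hp : p ≠ ⊤)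
    (s : Finset ι) (a : ι → K) {i₀ : ι} (hi₀ : i₀ ∈ s) (ha : a i₀ ≠ 0) :
    ∃ c : K, c ≠ 0 ∧ (∀ i ∈ s, ∃ b : R, algebraMap R K b = c * a i) ∧
      ∃ i ∈ s, ∀ b : R, algebraMap R K b = c * a i → b ∉ p := by
  classical
  let I : FractionalIdeal (nonZeroDivisors R) K := FractionalIdeal.spanFinset R s a
  have hmem : ∀ i ∈ s, a i ∈ I := fun i hi ↦
    Submodule.subset_span (Set.mem_image_of_mem a (Finset.mem_coe.mpr hi))
  have hI : I ≠ 0 := fun h ↦ ha (by simpa [h] using hmem i₀ hi₀)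
  -- The scalar is taken in `I⁻¹` but outside `p I⁻¹`. These differ, since multiplying an inclusion
  -- by `I` would put `1` in `p`.
  have hlt : ¬ I⁻¹ ≤ (p : FractionalIdeal (nonZeroDivisors R) K) * I⁻¹ := fun h ↦ by
    have h1 := mul_le_mul_left h I
    rw [mul_assoc, inv_mul_cancel₀ hI, mul_one, FractionalIdeal.one_le,
      FractionalIdeal.mem_coeIdeal] at h1
    obtain ⟨x, hx, hx1⟩ := h1
    rw [map_eq_one_iff _ (IsFractionRing.injective R K)] at hx1
    exact hp ((Ideal.eq_top_iff_one p).mpr (hx1 ▸ hx))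
  obtain ⟨c, hc, hcp⟩ := SetLike.not_le_iff_exists.mp hlt
  refine ⟨c, fun h0 ↦ hcp (h0 ▸ Submodule.zero_mem (p * I⁻¹ :
    FractionalIdeal (nonZeroDivisors R) K).coeToSubmodule), fun i hi ↦ ?_, ?_⟩
  · have := FractionalIdeal.mul_mem_mul hc (hmem i hi)
    rw [inv_mul_cancel₀ hI, FractionalIdeal.mem_one_iff] at this
    exact this
  · by_contra! hall
    apply hcp
    have hle : FractionalIdeal.spanSingleton (nonZeroDivisors R) c * I ≤ p := by
      rw [FractionalIdeal.spanSingleton_mul_le_iff]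
      intro x hx
      refine Submodule.span_induction (p := fun x _ ↦ c * x ∈
        (p : FractionalIdeal (nonZeroDivisors R) K)) ?_ ?_ ?_ ?_ hx
      · rintro _ ⟨i, hi, rfl⟩
        obtain ⟨b, hb, hbp⟩ := hall i hi
        rw [FractionalIdeal.mem_coeIdeal]
        exact ⟨b, hbp, hb⟩
      · simp
      · intro x y _ _ h1 h2
        rw [mul_add]
        exact Submodule.add_mem _ h1 h2
      · intro r x _ h1
        rw [mul_smul_comm]
        exact Submodule.smul_mem _ r h1
    have h2 := mul_le_mul_left hle I⁻¹
    rw [mul_assoc, mul_inv_cancel₀ hI, mul_one] at h2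
    exact h2 (FractionalIdeal.mem_spanSingleton_self _ c)

lemma AlgebraicGeometry.Scheme.Hom.ker_app_eq_ker_appLE {X Y : Scheme.{u}} (f : X ⟶ Y) {U : Y.Opens}
    {V : X.Opens} (h : V = f ⁻¹ᵁ U) :
    RingHom.ker (f.app U).hom = RingHom.ker (f.appLE U V h.le).hom := by
  subst h
  rw [Scheme.Hom.app_eq_appLE]

namespace MvPolynomial

/-- Used to see that a polynomial that is not irreducible over a field does not become irreducible
over an extension. -/
lemma isLocalHom_map {σ E L : Type*} [Field E] [Field L] (φ : E →+* L) :
    IsLocalHom (map (σ := σ) φ) := by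
  refine ⟨fun a ha ↦ ?_⟩
  rw [isUnit_iff_eq_C_of_isReduced] at ha ⊢
  obtain ⟨r, hr, h⟩ := ha
  have ht : a = C (coeff 0 a) := by
    classical
    ext m
    have hm := congr(coeff m $h)
    rw [coeff_map, coeff_C] at hm
    rw [coeff_C]
    split_ifs at hm ⊢ with h0
    · rw [h0]
    · exact (map_eq_zero φ).mp hm
  refine ⟨_, ?_, ht⟩
  rw [ht, map_C] at h
  have h' : φ (coeff 0 a) ≠ 0 := by
    rw [C_injective _ _ h]; exact hr.ne_zero
  exact isUnit_iff_ne_zero.mpr fun h0 ↦ h' (by rw [h0, map_zero])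

variable {σ R K : Type*} [CommRing R] [IsDedekindDomain R] [Field K] [Algebra R K]
  [IsFractionRing R K]

/-- The scalar depends on `p`: when the content ideal is not principal, no scalar makes the
polynomial primitive at all primes simultaneously. -/
lemma exists_C_mul_eq_map (p : Ideal R) (hp : p ≠ ⊤) {f : MvPolynomial σ K} (hf : f ≠ 0) :
    ∃ (c : K) (g : MvPolynomial σ R), c ≠ 0 ∧ map (algebraMap R K) g = C c * f ∧
      map (Ideal.Quotient.mk p) g ≠ 0 := by
  obtain ⟨m₀, hm₀⟩ := ne_zero_iff.mp hf
  obtain ⟨c, hc0, hc, m, hm, hcm⟩ := IsDedekindDomain.exists_smul_notMem p hp f.support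
    (fun m ↦ f.coeff m) (mem_support_iff.mpr hm₀) hm₀
  have hmem : C c * f ∈ Set.range (map (σ := σ) (algebraMap R K)) := by
    rw [mem_range_map_iff_coeffs_subset]
    intro x hx
    obtain ⟨m, -, rfl⟩ := mem_coeffs_iff.mp hx
    rw [coeff_C_mul]
    by_cases hm : m ∈ f.support
    · obtain ⟨b, hb⟩ := hc m hm
      exact ⟨b, hb⟩
    · exact ⟨0, by simp [notMem_support_iff.mp hm]⟩
  obtain ⟨g, hg⟩ := hmem
  refine ⟨c, g, hc0, hg, fun h0 ↦ hcm (g.coeff m) ?_ ?_⟩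
  · rw [← coeff_map, hg, coeff_C_mul]
  · rw [← Ideal.Quotient.eq_zero_iff_mem, ← coeff_map, h0, coeff_zero]

/-- **Gauss's lemma**: divisibility over the fraction field by a polynomial whose reduction modulo a
prime is nonzero passes to the reduction. -/
lemma map_dvd_map_of_dvd (p : Ideal R) [p.IsPrime] {f g : MvPolynomial σ R}
    (hf : map (Ideal.Quotient.mk p) f ≠ 0)
    (h : map (algebraMap R K) f ∣ map (algebraMap R K) g) {E : Type*} [Field E] (φ : R →+* E)
    (hφ : RingHom.ker φ = p) : map φ f ∣ map φ g := by
  have hinj : Function.Injective (map (σ := σ) (algebraMap R K)) :=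
    map_injective _ (IsFractionRing.injective R K)
  obtain ⟨h, hh⟩ := h
  by_cases h0 : h = 0
  · rw [h0, mul_zero, map_eq_zero_iff _ hinj] at hh
    simp [hh]
  obtain ⟨c, q, hc0, hq, hqp⟩ := exists_C_mul_eq_map (R := R) p (Ideal.IsPrime.ne_top ‹_›) h0
  -- Clearing denominators in the pair `(c, 1)` while keeping it nonzero modulo `p` gives the
  -- integral relation `t f q = s g`.
  obtain ⟨e, he0, he, i, -, hi⟩ := IsDedekindDomain.exists_smul_notMem (R := R) p
    (Ideal.IsPrime.ne_top ‹_›) Finset.univ ![c, 1] (Finset.mem_univ 1) (by simp)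
  obtain ⟨s, hs⟩ := he 0 (Finset.mem_univ _)
  obtain ⟨t, ht⟩ := he 1 (Finset.mem_univ _)
  have hst : C t * (f * q) = C s * g := by
    apply hinj
    simp only [map_mul, map_C, hh, hq, hs, ht]
    simp
    ring
  -- If `s` were in `p`, then `t` would not be, and the relation modulo `p` would make a product of
  -- nonzero polynomials over a domain vanish.
  have hsp : s ∉ p := fun hsp ↦ by
    have htp : t ∉ p := by
      fin_cases i
      exacts [absurd hsp (hi s hs), hi t ht]
    have := congr(map (Ideal.Quotient.mk p) $hst)
    simp only [map_mul, map_C, Ideal.Quotient.eq_zero_iff_mem.mpr hsp, map_zero, zero_mul,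
      mul_eq_zero, hf, hqp, or_false, C_eq_zero] at this
    exact htp (Ideal.Quotient.eq_zero_iff_mem.mp this)
  have hu : IsUnit (C (φ s) : MvPolynomial σ E) :=
    (isUnit_iff_ne_zero.mpr fun h ↦ hsp (hφ ▸ (RingHom.mem_ker.mpr h))).map C
  rw [← hu.dvd_mul_left]
  have := congr(map φ $hst)
  simp only [map_mul, map_C] at this
  rw [← this]
  exact ⟨C (φ t) * map φ q, by ring⟩

end MvPolynomial

/-! ### Equations of the Zariski closure and of its fibres. -/

namespace PlaneCurve

open MvPolynomial HomogeneousLocalization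

noncomputable section

instance {R : Type u} [CommRing R] : CompactSpace (Plane R) := by
  refine ⟨?_⟩
  have := isCompact_iUnion fun j : Fin 3 ↦ (isAffineOpen_chart (R := R) j).isCompact
  rwa [← TopologicalSpace.Opens.coe_iSup, iSup_chart] at this

section

variable {R S : Type u} [CommRing R] [CommRing S] [Algebra R S]

variable (R S) in
lemma map_preimage_chart (j : Fin 3) :
    Plane.map R S ⁻¹ᵁ Plane.chart R j = Plane.chart S j := by
  have : gradedMap R S (X j) = X j := map_X (algebraMap R S) j
  rw [Plane.map, Proj.map_preimage_basicOpen, this]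

lemma awayToSection_comp_appLE (j : Fin 3) :
    Proj.awayToSection (grading R) (X j) ≫
      (Plane.map R S).appLE (Plane.chart R j) (Plane.chart S j) (map_preimage_chart R S j).ge =
    CommRingCat.ofHom (Chart.map R S j) ≫ Proj.awayToSection (grading S) (X j) := by
  ext x
  obtain ⟨n, f, hf, rfl⟩ := Chart.exists_frac x
  refine Subtype.ext <| funext fun p ↦ ?_
  change HomogeneousLocalization.mk _ = HomogeneousLocalization.mk _
  ext
  simp [gradedMap]

end

section Reduction

variable {K : Type u} [Field K] {X : Scheme.{u}} (i : X ⟶ Plane K) {d : ℕ}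
  {f : MvPolynomial (Fin 3) K} {hf : f.IsHomogeneous d}

lemma IsCutOutBy.ker_restrictChart (hX : IsCutOutBy i hf) (j : Fin 3) :
    RingHom.ker (restrictChart i j).hom = Ideal.span {Chart.frac j hf} := by
  have hb := awayToSection_bijective (R := K) j
  have h1 : RingHom.ker (restrictChart i j).hom =
      (RingHom.ker (i.app (Plane.chart K j)).hom).comap
        (Proj.awayToSection (grading K) (MvPolynomial.X j)).hom := rfl
  rw [h1, hX.ker_app_chart]
  ext x
  rw [Ideal.mem_comap, Ideal.mem_span_singleton, Ideal.mem_span_singleton]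
  change (Proj.awayToSection (grading K) (MvPolynomial.X j)).hom _ ∣ _ ↔ _
  exact map_dvd_iff (RingEquiv.ofBijective _ hb)

lemma IsCutOutBy.irreducible_map (hX : IsCutOutBy i hf) (hf0 : f ≠ 0)
    (hXint : GeometricallyIntegral (i ≫ Plane.toSpec K)) (E : Type u) [Field E] [Algebra K E] :
    Irreducible (map (algebraMap K E) f) := by
  have := hX.isClosedImmersion
  have h := IsPullback.of_hasPullback (i ≫ Plane.toSpec K)
    (Spec.map (CommRingCat.ofHom (algebraMap K E)))
  have : IsIntegral (pullback (i ≫ Plane.toSpec K)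
    (Spec.map (CommRingCat.ofHom (algebraMap K E)))) := hXint.geometrically_isIntegral _ _ _ h
  refine irreducible_of_isIntegral i (hf.map _) h (fun j ↦ ?_) ?_
  · rw [chartIdeal, hX.ker_restrictChart, Ideal.map_span, Set.image_singleton, Chart.map_frac]
  · rwa [Ne, map_eq_zero_iff _ (map_injective _ (algebraMap K E).injective)]

/-- A function vanishes on the scheme-theoretic image exactly when its pullback to `X` vanishes, and
on a chart this pullback passes through the chart over `K`. Quasi-compactness allows the image to be
computed on affine opens. -/
lemma IsCutOutBy.ker_restrictChart_imageι (hX : IsCutOutBy i hf) (j : Fin 3) :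
    RingHom.ker (restrictChart (i ≫ Plane.map (𝓞 K) K).imageι j).hom =
      (Ideal.span {Chart.frac j hf}).comap (Chart.map (𝓞 K) K j) := by
  have := hX.isClosedImmersion
  have : CompactSpace X := QuasiCompact.compactSpace_of_compactSpace i
  have h1 : RingHom.ker (restrictChart (i ≫ Plane.map (𝓞 K) K).imageι j).hom =
      (RingHom.ker ((i ≫ Plane.map (𝓞 K) K).imageι.app (Plane.chart (𝓞 K) j)).hom).comap
        (Proj.awayToSection (grading (𝓞 K)) (MvPolynomial.X j)).hom := rfl
  have h2 : RingHom.ker ((i ≫ Plane.map (𝓞 K) K).imageι.app (Plane.chart (𝓞 K) j)).hom =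
      RingHom.ker ((i ≫ Plane.map (𝓞 K) K).app (Plane.chart (𝓞 K) j)).hom :=
    (Scheme.IdealSheafData.ker_subschemeι_app _ ⟨_, isAffineOpen_chart j⟩).trans
      (Scheme.Hom.ker_apply _ _)
  have h3 : RingHom.ker ((i ≫ Plane.map (𝓞 K) K).app (Plane.chart (𝓞 K) j)).hom =
      RingHom.ker ((Plane.map (𝓞 K) K).appLE (Plane.chart (𝓞 K) j) (Plane.chart K j)
        (map_preimage_chart (𝓞 K) K j).ge ≫ i.app (Plane.chart K j)).hom := by
    rw [Scheme.Hom.app_eq_appLE i, Scheme.Hom.appLE_comp_appLE]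
    exact Scheme.Hom.ker_app_eq_ker_appLE _ (by rw [← map_preimage_chart (𝓞 K) K j]; rfl)
  rw [h1, h2, h3, ← hX.ker_restrictChart]
  ext x
  simp only [Ideal.mem_comap, RingHom.mem_ker, restrictChart]
  have h4 := congr(($(awayToSection_comp_appLE (R := 𝓞 K) (S := K) j)).hom x)
  simp only [CommRingCat.hom_comp, RingHom.comp_apply, CommRingCat.hom_ofHom] at h4 ⊢
  rw [h4]

variable {i} [NumberField K]

/-- Failure of geometric integrality is witnessed over some extension of the residue field, over
which the fibre is the plane curve defined by the image of `g`. Passing to an algebraic closure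
preserves reducibility. -/
lemma IsCutOutBy.exists_not_irreducible (hX : IsCutOutBy i hf)
    {p : MaximalSpectrum (𝓞 K)} (hp : p ∈ badPrimes i) {c : K} (hc : c ≠ 0)
    {g : MvPolynomial (Fin 3) (𝓞 K)} (hg : map (algebraMap (𝓞 K) K) g = C c * f)
    (hgp : map (Ideal.Quotient.mk p.asIdeal) g ≠ 0) :
    ∃ (E : Type u) (_ : Field E) (_ : IsAlgClosed E) (φ : 𝓞 K →+* E),
      RingHom.ker φ = p.asIdeal ∧ ¬ Irreducible (map φ g) := by
  have := hX.isClosedImmersion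
  have := p.isMaximal
  let := Ideal.Quotient.field p.asIdeal
  have hng : ¬ GeometricallyIntegral (reduction i p) := hp
  rw [geometricallyIntegral_iff, geometrically] at hng
  push Not at hng
  obtain ⟨E, _, y, Z, fst, snd, h, hZ⟩ := hng
  obtain ⟨ψ, rfl⟩ := Spec.map_surjective y
  let φ : 𝓞 K →+* E := ψ.hom.comp (Ideal.Quotient.mk p.asIdeal)
  let : Algebra (𝓞 K) E := φ.toAlgebra
  have hker : RingHom.ker φ = p.asIdeal := by
    refine (p.isMaximal.eq_of_le (RingHom.ker_ne_top φ) fun x hx ↦ ?_).symm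
    rw [RingHom.mem_ker, RingHom.comp_apply, Ideal.Quotient.eq_zero_iff_mem.mpr hx, map_zero]
  have hgh : g.IsHomogeneous d := by
    refine IsHomogeneous.of_map RingOfIntegers.coe_injective ?_
    rw [hg]
    simpa using (isHomogeneous_C (Fin 3) c).mul hf
  have hgE : map φ g ≠ 0 := by
    rw [← MvPolynomial.map_map, Ne, map_eq_zero_iff _ (map_injective ψ.hom (RingHom.injective (R := 𝓞 K ⧸ p.asIdeal) ψ.hom))]
    exact hgp
  have hpb : IsPullback (fst ≫ pullback.fst _ _) snd
      ((i ≫ Plane.map (𝓞 K) K).imageι ≫ Plane.toSpec (𝓞 K))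
      (Spec.map (CommRingCat.ofHom (algebraMap (𝓞 K) E))) := by
    have h2 := h.paste_horiz (IsPullback.of_hasPullback (zariskiClosureToSpec i)
      (Spec.map (CommRingCat.ofHom (Ideal.Quotient.mk p.asIdeal))))
    rwa [← Spec.map_comp] at h2
  have hirr : ¬ Irreducible (map φ g) := fun hirr ↦ hZ <|
    isIntegral_of_irreducible _ (hgh.map φ) hpb (fun j ↦ ?_) hirr
  · refine ⟨AlgebraicClosure E, inferInstance, inferInstance, (algebraMap E _).comp φ, ?_, ?_⟩
    · rw [← RingHom.comap_ker, (RingHom.injective_iff_ker_eq_bot _).mp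
        (algebraMap E (AlgebraicClosure E)).injective, ← RingHom.ker_eq_comap_bot, hker]
    · rw [← MvPolynomial.map_map]
      have := MvPolynomial.isLocalHom_map (σ := Fin 3) (algebraMap E (AlgebraicClosure E))
      exact fun h ↦ hirr (h.of_map)
  · rw [chartIdeal, hX.ker_restrictChart_imageι]
    have hfg : f ∣ map (algebraMap (𝓞 K) K) g := ⟨C c, by rw [hg, mul_comm]⟩
    have hgf : map (algebraMap (𝓞 K) K) g ∣ f := by
      rw [hg]
      exact ⟨C c⁻¹, by rw [mul_right_comm, ← C_mul, mul_inv_cancel₀ hc, C_1, one_mul]⟩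
    -- The nontrivial inclusion is Gauss's lemma: if `g` divides `Tⱼ ^ k * q` over `K`, the same
    -- holds after `φ`, and `Tⱼ` is invertible on the chart.
    refine le_antisymm (Ideal.map_le_iff_le_comap.mpr fun x hx ↦ ?_) ?_
    · obtain ⟨n, q, hq, rfl⟩ := Chart.exists_frac x
      rw [Ideal.mem_comap, Chart.map_frac, Ideal.mem_span_singleton] at hx ⊢
      obtain ⟨k, hk⟩ := Chart.exists_dvd_X_pow_mul_of_frac_dvd_frac _ _ hx
      have h1 : MvPolynomial.map (algebraMap (𝓞 K) K) g ∣
          MvPolynomial.map (algebraMap (𝓞 K) K) (MvPolynomial.X j ^ k * q) := by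
        simpa using hgf.trans hk
      have h2 := map_dvd_map_of_dvd p.asIdeal hgp h1 φ hker
      have h3 := Chart.frac_dvd_frac (hgh.map φ) (j := j)
        (((isHomogeneous_X_pow j k).mul hq).map φ) h2
      convert h3 using 1
      rw [← one_mul (Chart.frac j _), ← Chart.frac_X_pow k, Chart.frac_mul_frac]
      congr 1
      simp
      rfl
    · rw [Ideal.span_singleton_le_iff_mem]
      have h1 := Chart.map_frac (S := E) (j := j) hgh
      have h2 : Chart.frac j hgh ∈
          (Ideal.span {Chart.frac j hf}).comap (Chart.map (𝓞 K) K j) := by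
        rw [Ideal.mem_comap, Chart.map_frac, Ideal.mem_span_singleton]
        exact Chart.frac_dvd_frac hf _ hfg
      exact h1 ▸ Ideal.mem_map_of_mem _ h2

end Reduction

end

end PlaneCurve

/-! ### Reducible forms give closed 1-forms, in any characteristic. -/

namespace MvPolynomial

lemma coeff_mul_eq_zero_of_pderiv_eq_zero {σ R : Type*} [CommSemiring R] {f : MvPolynomial σ R}
    {i : σ} (hf : pderiv i f = 0) (m : σ →₀ ℕ) : coeff m f * (m i : R) = 0 := by
  classical
  rcases Nat.eq_zero_or_pos (m i) with h | h
  · simp [h]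
  · have h1 : m - Finsupp.single i 1 + Finsupp.single i 1 = m :=
      tsub_add_cancel_of_le (Finsupp.single_le_iff.mpr h)
    have := coeff_pderiv (i := i) f (m - Finsupp.single i 1)
    rw [h1, hf, coeff_zero] at this
    rw [this]
    have h2 : ((m i : ℕ) : R) = ((m i - 1 + 1 : ℕ) : R) := by rw [Nat.sub_add_cancel h]
    rw [h2]
    simp

/-- Over an algebraically closed field, a nonconstant polynomial all of whose partial derivatives
vanish is a proper power. -/
lemma exists_eq_pow_of_pderiv_eq_zero {σ E : Type*} [Field E] [IsAlgClosed E]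
    {f : MvPolynomial σ E} (hf : ∀ i, pderiv i f = 0) (hc : ∀ c, f ≠ C c) :
    ∃ (q : ℕ) (g : MvPolynomial σ E), 2 ≤ q ∧ f = g ^ q := by
  classical
  obtain ⟨q, hq⟩ := ExpChar.exists E
  rcases hq with _ | hq
  · refine absurd ?_ (hc (coeff 0 f))
    ext m
    rw [coeff_C]
    split_ifs with h
    · rw [h]
    · by_contra hm
      refine h (Finsupp.ext fun i ↦ ?_).symm
      have := coeff_mul_eq_zero_of_pderiv_eq_zero (hf i) m
      simpa [hm] using this
  -- In characteristic `q` all exponents are divisible by `q` and all coefficients have `q`-th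
  -- roots, so Frobenius exhibits `f` as a `q`-th power.
  · have := Fact.mk hq
    refine ⟨q, ∑ m ∈ f.support, monomial (m.mapRange (· / q) (Nat.zero_div q))
      (IsAlgClosed.exists_pow_nat_eq (coeff m f) hq.pos).choose, hq.two_le, ?_⟩
    rw [sum_pow_char]
    conv_lhs => rw [f.as_sum]
    refine Finset.sum_congr rfl fun m hm ↦ ?_
    rw [monomial_pow, (IsAlgClosed.exists_pow_nat_eq (coeff m f) hq.pos).choose_spec]
    congr 2
    ext i
    have h1 : ((m i : ℕ) : E) = 0 := by
      have := coeff_mul_eq_zero_of_pderiv_eq_zero (hf i) m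
      exact (mul_eq_zero.mp this).resolve_left (mem_support_iff.mp hm)
    rw [CharP.cast_eq_zero_iff E q] at h1
    simp [Nat.mul_div_cancel' h1]

end MvPolynomial

namespace PlaneCurve

open MvPolynomial

noncomputable section

section

variable {R : Type*} [CommRing R]

/-- The numerator of the coefficient of the exterior derivative of `(r dT₁ + s dT₂) / F`. -/
def ruppert (F r s : MvPolynomial (Fin 3) R) : MvPolynomial (Fin 3) R :=
  F * (pderiv 2 r - pderiv 1 s) - r * pderiv 2 F + s * pderiv 1 F

lemma pderiv_comm {σ : Type*} (i j : σ) (f : MvPolynomial σ R) :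
    pderiv i (pderiv j f) = pderiv j (pderiv i f) := by
  classical
  ext m
  simp only [coeff_pderiv, Finsupp.add_apply, Finsupp.single_apply]
  by_cases h : i = j
  · subst h; rfl
  · rw [add_right_comm]
    simp [h, Ne.symm h]
    ring

/-- This is the closedness of `d(L / A)`, written with denominator `A² C`. -/
lemma ruppert_mul_sub (A C L : MvPolynomial (Fin 3) R) :
    ruppert (A * (A * C)) (C * (A * pderiv 1 L - L * pderiv 1 A))
      (C * (A * pderiv 2 L - L * pderiv 2 A)) = 0 := by
  simp only [ruppert, pderiv_mul, map_sub]
  rw [pderiv_comm 2 1 A, pderiv_comm 2 1 L]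
  ring

/-- This is the closedness of `b dA / A - a dB / B` for `a`, `b` with zero derivatives. -/
lemma ruppert_mul (A B a b : MvPolynomial (Fin 3) R) (ha : ∀ i, pderiv i a = 0)
    (hb : ∀ i, pderiv i b = 0) :
    ruppert (A * B) (b * (B * pderiv 1 A) - a * (A * pderiv 1 B))
      (b * (B * pderiv 2 A) - a * (A * pderiv 2 B)) = 0 := by
  simp only [ruppert, pderiv_mul, map_sub, ha, hb]
  rw [pderiv_comm 2 1 A, pderiv_comm 2 1 B]
  ring

end

section

variable {E : Type*} [Field E] {d : ℕ} {F : MvPolynomial (Fin 3) E}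

lemma isUnit_of_isHomogeneous_zero {σ : Type*} {A : MvPolynomial σ E} (hA : A.IsHomogeneous 0)
    (hA0 : A ≠ 0) : IsUnit A := by
  rw [← totalDegree_zero_iff_isHomogeneous, totalDegree_eq_zero_iff_eq_C] at hA
  rw [hA] at hA0 ⊢
  exact IsUnit.map C (isUnit_iff_ne_zero.mpr fun h0 ↦ hA0 (by rw [h0, C_0]))

lemma eq_zero_of_dvd_of_isHomogeneous {σ : Type*} {A B : MvPolynomial σ E} {a b : ℕ}
    (hA : A.IsHomogeneous a) (hB : B.IsHomogeneous b) (hab : b < a) (h : A ∣ B) : B = 0 := by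
  by_contra hB0
  obtain ⟨C, rfl⟩ := h
  obtain ⟨a', c, hac, hA', hC⟩ := hB.exists_of_mul hB0
  have := hA.inj_right hA' (left_ne_zero_of_mul hB0)
  omega

/-- A nonzero solution of the linear system attached to `F`. -/
def HasRuppertSolution (F : MvPolynomial (Fin 3) E) (d : ℕ) : Prop :=
  ∃ r s : MvPolynomial (Fin 3) E, r.IsHomogeneous d ∧ s.IsHomogeneous d ∧
    X 0 ∣ X 1 * r + X 2 * s ∧ ¬ (r = 0 ∧ s = 0) ∧ ruppert F r s = 0

/-- The relation `hs` says that the form is killed by the Euler field. It also makes `G 0` vanish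
when `G 1` and `G 2` do, so any nonzero component suffices. -/
lemma HasRuppertSolution.of_form (G : Fin 3 → MvPolynomial (Fin 3) E)
    (hG : ∀ i, (G i).IsHomogeneous d) (hs : X 0 * G 0 + X 1 * G 1 + X 2 * G 2 = 0)
    (hr : ruppert F (G 1) (G 2) = 0) {i : Fin 3} (hi : G i ≠ 0) : HasRuppertSolution F d := by
  refine ⟨G 1, G 2, hG 1, hG 2, ⟨- G 0, by linear_combination hs⟩, fun h ↦ hi ?_, hr⟩
  have h0 : G 0 = 0 := by
    rw [h.1, h.2] at hs
    simpa using hs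
  fin_cases i
  exacts [h0, h.1, h.2]

lemma IsHomogeneous.euler {A : MvPolynomial (Fin 3) E} {a : ℕ} (hA : A.IsHomogeneous a) :
    X 0 * pderiv 0 A + X 1 * pderiv 1 A + X 2 * pderiv 2 A = (a : MvPolynomial (Fin 3) E) * A := by
  have := hA.sum_X_mul_pderiv
  rwa [Fin.sum_univ_three, nsmul_eq_mul] at this

lemma HasRuppertSolution.of_sq_dvd (hF : F.IsHomogeneous (d + 1)) (hF0 : F ≠ 0)
    {A : MvPolynomial (Fin 3) E} (hA : ¬ IsUnit A) (h : A * A ∣ F) : HasRuppertSolution F d := by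
  obtain ⟨B, rfl⟩ := h
  rw [mul_assoc] at hF hF0 ⊢
  obtain ⟨a, e, hae, hAa, hAB⟩ := hF.exists_of_mul hF0
  obtain ⟨a', b, hab, hAa', hB⟩ := hAB.exists_of_mul (right_ne_zero_of_mul hF0)
  have hA0 : A ≠ 0 := left_ne_zero_of_mul hF0
  have hB0 : B ≠ 0 := right_ne_zero_of_mul (right_ne_zero_of_mul hF0)
  obtain rfl := hAa.inj_right hAa' hA0
  obtain ⟨a, rfl⟩ : ∃ k, a = k + 1 := Nat.exists_eq_succ_of_ne_zero fun h ↦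
    hA (isUnit_of_isHomogeneous_zero (h ▸ hAa) hA0)
  have key (L : MvPolynomial (Fin 3) E) (hL : L.IsHomogeneous (a + 1)) (i : Fin 3)
      (hi : A * pderiv i L - L * pderiv i A ≠ 0) : HasRuppertSolution (A * (A * B)) d := by
    refine .of_form (fun i ↦ B * (A * pderiv i L - L * pderiv i A)) (fun i ↦ ?_) ?_
      (ruppert_mul_sub A B L) (i := i) (mul_ne_zero hB0 hi)
    · have h1 := hB.mul ((hAa.mul (hL.pderiv (i := i))).sub (hL.mul (hAa.pderiv (i := i))))
      rw [show b + (a + 1 + (a + 1 - 1)) = d by omega] at h1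
      exact h1
    · linear_combination B * A * IsHomogeneous.euler hL - B * L * IsHomogeneous.euler hAa
  -- With `deg A = a + 1`, the numerators `T₀ ^ a T₁` and `T₀ ^ a T₂` are tried for `L`. If both
  -- `∂₁`-components vanished, the second would give `∂₁A = 0` and then the first `A = 0`.
  have hX (j : Fin 3) : (X 0 ^ a * X j : MvPolynomial (Fin 3) E).IsHomogeneous (a + 1) :=
    (isHomogeneous_X_pow 0 a).mul (isHomogeneous_X E j)
  have hX0 : (X 0 ^ a : MvPolynomial (Fin 3) E) ≠ 0 := pow_ne_zero _ (X_ne_zero 0)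
  by_contra hn
  have h1 : A * pderiv 1 (X 0 ^ a * X 1) - X 0 ^ a * X 1 * pderiv 1 A = 0 := by
    by_contra h1
    exact hn (key _ (hX 1) 1 h1)
  have h2 : A * pderiv 1 (X 0 ^ a * X 2) - X 0 ^ a * X 2 * pderiv 1 A = 0 := by
    by_contra h2
    exact hn (key _ (hX 2) 1 h2)
  simp at h1 h2
  rw [h2] at h1
  simp [hA0] at h1

/-- Square factors are handled by `of_sq_dvd`. Otherwise write `F = AB` with `A` irreducible and not
dividing `B`, and use logarithmic forms; these can vanish only if all derivatives of `A` or of `B`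
do, which would make that factor a proper power and produce a square factor. -/
lemma HasRuppertSolution.of_not_irreducible [IsAlgClosed E] (hF : F.IsHomogeneous (d + 1))
    (hF0 : F ≠ 0) (hirr : ¬ Irreducible F) : HasRuppertSolution F d := by
  have hu : ¬ IsUnit F := fun hu ↦ by
    obtain ⟨c, hc, rfl⟩ := (MvPolynomial.isUnit_iff_eq_C_of_isReduced).mp hu
    simpa using hF.inj_right (isHomogeneous_C _ _) hF0
  have hpow {A : MvPolynomial (Fin 3) E} (hA : ¬ IsUnit A) (hA0 : A ≠ 0)
      (h : ∀ i, pderiv i A = 0) : ∃ B, ¬ IsUnit B ∧ B * B ∣ A := by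
    obtain ⟨q, B, hq, rfl⟩ := exists_eq_pow_of_pderiv_eq_zero h fun c hc ↦ hA <| by
      rw [hc] at hA0 ⊢
      exact IsUnit.map C (isUnit_iff_ne_zero.mpr fun h0 ↦ hA0 (by rw [h0, C_0]))
    exact ⟨B, fun hB ↦ hA (hB.pow q), by rw [← sq]; exact pow_dvd_pow B hq⟩
  by_contra hn
  have hsq (B : MvPolynomial (Fin 3) E) (hB : ¬ IsUnit B) : ¬ B * B ∣ F := fun h ↦
    hn (.of_sq_dvd hF hF0 hB h)
  obtain ⟨A, hA, B, rfl⟩ := WfDvdMonoid.exists_irreducible_factor hu hF0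
  have hA0 : A ≠ 0 := left_ne_zero_of_mul hF0
  have hB0 : B ≠ 0 := right_ne_zero_of_mul hF0
  have hBu : ¬ IsUnit B := fun hB ↦ hirr ((irreducible_mul_isUnit hB).mpr hA)
  obtain ⟨a, b, hab, hAa, hBb⟩ := hF.exists_of_mul hF0
  have ha : a ≠ 0 := fun h ↦ hA.not_isUnit (isUnit_of_isHomogeneous_zero (h ▸ hAa) hA0)
  have hb : b ≠ 0 := fun h ↦ hBu (isUnit_of_isHomogeneous_zero (h ▸ hBb) hB0)
  have hdA : ¬ ∀ i, pderiv i A = 0 := fun h ↦ by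
    obtain ⟨D, hD, hDA⟩ := hpow hA.not_isUnit hA0 h
    exact hsq D hD (hDA.mul_right B)
  have hdB : ¬ ∀ i, pderiv i B = 0 := fun h ↦ by
    obtain ⟨D, hD, hDB⟩ := hpow hBu hB0 h
    exact hsq D hD (hDB.mul_left A)
  have hAB : ¬ A ∣ B := fun h ↦ hsq A hA.not_isUnit (mul_dvd_mul_left A h)
  -- The form `u dA / A - v dB / B` descends to the plane exactly when its contraction with the
  -- Euler field, `u a - v b`, is zero.
  have key (u v : E) (huv : u * a = v * b) (i : Fin 3)
      (hi : C u * (B * pderiv i A) - C v * (A * pderiv i B) ≠ 0) :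
      HasRuppertSolution (A * B) d := by
    refine .of_form (fun i ↦ C u * (B * pderiv i A) - C v * (A * pderiv i B)) (fun i ↦ ?_) ?_
      (ruppert_mul A B (C v) (C u) (fun _ ↦ pderiv_C) (fun _ ↦ pderiv_C)) (i := i) hi
    · have h1 := (isHomogeneous_C (Fin 3) u).mul (hBb.mul (hAa.pderiv (i := i)))
      have h2 := (isHomogeneous_C (Fin 3) v).mul (hAa.mul (hBb.pderiv (i := i)))
      rw [show 0 + (b + (a - 1)) = d by omega] at h1
      rw [show 0 + (a + (b - 1)) = d by omega] at h2
      exact h1.sub h2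
    · have huv' : (C u * (a : MvPolynomial (Fin 3) E)) =
          C v * (b : MvPolynomial (Fin 3) E) := by
        rw [← map_natCast (C (σ := Fin 3) (R := E)), ← map_natCast (C (σ := Fin 3) (R := E)),
          ← C_mul, ← C_mul, huv]
      linear_combination C u * B * IsHomogeneous.euler hAa - C v * A * IsHomogeneous.euler hBb +
        A * B * huv'
  have hzero (u v : E) (huv : u * a = v * b) (i : Fin 3) :
      C u * pderiv i A = 0 ∧ C v * pderiv i B = 0 := by
    have h0 : C u * (B * pderiv i A) - C v * (A * pderiv i B) = 0 := by
      by_contra h0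
      exact hn (key u v huv i h0)
    have h1 : A ∣ B * (C u * pderiv i A) := ⟨C v * pderiv i B, by linear_combination h0⟩
    have h2 := (hA.prime.dvd_or_dvd h1).resolve_left hAB
    have h3 : C u * pderiv i A = 0 := by
      refine eq_zero_of_dvd_of_isHomogeneous hAa
        ((isHomogeneous_C (Fin 3) u).mul (hAa.pderiv (i := i))) (by omega) h2
    refine ⟨h3, ?_⟩
    have h4 : A * (C v * pderiv i B) = 0 := by linear_combination - h0 + B * h3
    exact (mul_eq_zero.mp h4).resolve_left hA0
  -- The weights are `(u, v) = (b, a)`, unless both degrees vanish in `E`; then `dA / A` alone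
  -- descends and `(1, 0)` is used.
  by_cases hb0 : (b : E) = 0
  · by_cases ha0 : (a : E) = 0
    · exact hdA fun i ↦ by simpa using (hzero 1 0 (by simp [ha0]) i).1
    · exact hdB fun i ↦ (mul_eq_zero.mp (hzero b a (mul_comm _ _) i).2).resolve_left (C_ne_zero.mpr ha0)
  · exact hdA fun i ↦ (mul_eq_zero.mp (hzero b a (mul_comm _ _) i).1).resolve_left (C_ne_zero.mpr hb0)

end

end

end PlaneCurve

open scoped TensorProduct in
/-- In characteristic zero, the differential of a transcendental element is nonzero. -/
lemma Transcendental.kaehlerDifferential_D_ne_zero {E L : Type*} [Field E] [CharZero E] [Field L]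
    [Algebra E L] [Algebra.EssFiniteType E L] {a : L} (ha : Transcendental E a) :
    KaehlerDifferential.D E L a ≠ 0 := by
  let S := Polynomial E
  let : Algebra S L := (Polynomial.aeval a).toAlgebra
  have hinj : Function.Injective (algebraMap S L) := transcendental_iff_injective.mp ha
  have : FaithfulSMul S L := (faithfulSMul_iff_algebraMap_injective S L).mpr hinj
  have hst : IsScalarTower E S L := .of_algHom (Polynomial.aeval a)
  let := FractionRing.liftAlgebra S L
  have : IsScalarTower S (FractionRing S) L := FractionRing.isScalarTower_liftAlgebra S L
  have : IsScalarTower E (FractionRing S) L := by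
    refine .of_algebraMap_eq fun x ↦ ?_
    rw [IsScalarTower.algebraMap_apply E S (FractionRing S), ← IsScalarTower.algebraMap_apply S,
      ← IsScalarTower.algebraMap_apply E S]
  have : Algebra.EssFiniteType (FractionRing S) L := .of_comp E (FractionRing S) L
  have : CharZero (FractionRing S) := charZero_of_injective_algebraMap
    (algebraMap E (FractionRing S)).injective
  have : Algebra.FormallySmooth S (FractionRing S) := .of_isLocalization (nonZeroDivisors S)
  have : Algebra.FormallySmooth S L := .comp S (FractionRing S) L
  -- `L` is formally smooth over `E(x)` in characteristic zero, hence over `S = E[x]`. So `L ⊗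
  -- Ω[S⁄E]` embeds in the differentials of `L`, with `dx` going to `da`.
  have hsub : Subsingleton (Algebra.H1Cotangent S L) :=
    Algebra.FormallySmooth.subsingleton_h1Cotangent
  have hker : Function.Injective (KaehlerDifferential.mapBaseChange E S L) := by
    rw [injective_iff_map_eq_zero]
    intro x hx
    obtain ⟨y, rfl⟩ := (Algebra.H1Cotangent.exact_δ_mapBaseChange E S L x).mp hx
    rw [Subsingleton.elim y 0, map_zero]
  intro h0
  have h1 : (1 : L) ⊗ₜ[S] KaehlerDifferential.D E S Polynomial.X = 0 := by
    apply hker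
    rw [KaehlerDifferential.mapBaseChange_tmul, KaehlerDifferential.map_D, map_zero, one_smul]
    have : algebraMap S L Polynomial.X = a := Polynomial.aeval_X a
    rw [this, h0]
  have h2 : (1 : L) ⊗ₜ[S] (KaehlerDifferential.polynomialEquiv E
      (KaehlerDifferential.D E S Polynomial.X)) = 0 := by
    have := congr(LinearMap.lTensor L (KaehlerDifferential.polynomialEquiv E).toLinearMap $h1)
    rwa [map_zero] at this
  rw [KaehlerDifferential.polynomialEquiv_D, Polynomial.derivative_X] at h2
  have h3 := congr(TensorProduct.rid S L $h2)
  rw [TensorProduct.rid_tmul, one_smul, map_zero] at h3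
  exact one_ne_zero h3

namespace PlaneCurve

open MvPolynomial

noncomputable section

section

variable {E : Type u} [Field E] {d : ℕ} {F : MvPolynomial (Fin 3) E}

/-- The ideal of the polynomials vanishing on the affine part `T₀ = 1` of the curve `F = 0`. -/
def affineIdeal (hF : F.IsHomogeneous d) : Ideal (MvPolynomial (Fin 3) E) :=
  RingHom.ker ((Ideal.Quotient.mk (Ideal.span {Chart.frac 0 hF})).comp
    (eval₂Hom (Chart.const E 0) (Chart.coord E 0)))

lemma mem_affineIdeal_iff (hF : F.IsHomogeneous d) {n : ℕ} {g : MvPolynomial (Fin 3) E}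
    (hg : g.IsHomogeneous n) : g ∈ affineIdeal hF ↔ Chart.frac 0 hF ∣ Chart.frac 0 hg := by
  rw [affineIdeal, RingHom.mem_ker, RingHom.comp_apply, Ideal.Quotient.eq_zero_iff_mem,
    Ideal.mem_span_singleton, Chart.frac_eq_eval₂ hg, coe_eval₂Hom]

lemma isPrime_affineIdeal (hF : F.IsHomogeneous d) (hp : Prime F) (hX : ¬ F ∣ X 0) :
    (affineIdeal hF).IsPrime := by
  have hpr := Chart.prime_frac hF hp hX
  have := (Ideal.span_singleton_prime hpr.ne_zero).mpr hpr
  exact RingHom.ker_isPrime _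

lemma dvd_of_mem_affineIdeal (hF : F.IsHomogeneous d) (hp : Prime F) (hX : ¬ F ∣ X 0) {n : ℕ}
    {g : MvPolynomial (Fin 3) E} (hg : g.IsHomogeneous n) (h : g ∈ affineIdeal hF) : F ∣ g := by
  obtain ⟨k, hk⟩ := Chart.exists_dvd_X_pow_mul_of_frac_dvd_frac hF hg
    ((mem_affineIdeal_iff hF hg).mp h)
  exact (hp.dvd_or_dvd hk).resolve_left fun h ↦ hX (hp.dvd_of_dvd_pow h)

lemma self_mem_affineIdeal (hF : F.IsHomogeneous d) : F ∈ affineIdeal hF :=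
  (mem_affineIdeal_iff hF hF).mpr dvd_rfl

lemma X_sub_one_mem_affineIdeal (hF : F.IsHomogeneous d) : X 0 - 1 ∈ affineIdeal hF := by
  rw [affineIdeal, RingHom.mem_ker, RingHom.comp_apply]
  simp [Chart.coord_self]

/-- A logarithmic differential form on a curve over an algebraically closed field of
characteristic zero has constant residue. -/
lemma exists_residue [IsAlgClosed E] [CharZero E] (hF : F.IsHomogeneous d) (hp : Prime F)
    (hX : ¬ F ∣ X 0) {r s : MvPolynomial (Fin 3) E} (hr : ruppert F r s = 0)
    (hd : ¬ (pderiv 1 F ∈ affineIdeal hF ∧ pderiv 2 F ∈ affineIdeal hF)) :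
    ∃ c : E, r - C c * pderiv 1 F ∈ affineIdeal hF ∧ s - C c * pderiv 2 F ∈ affineIdeal hF := by
  have := isPrime_affineIdeal hF hp hX
  -- `L` is the function field of the curve, in coordinates with `T₀ = 1`.
  obtain ⟨L, _, _, _, φ, hφ⟩ : ∃ (L : Type u) (_ : Field L) (_ : Algebra E L)
      (_ : Algebra.EssFiniteType E L) (φ : MvPolynomial (Fin 3) E →ₐ[E] L),
      ∀ g, φ g = 0 ↔ g ∈ affineIdeal hF := by
    refine ⟨FractionRing (MvPolynomial (Fin 3) E ⧸ affineIdeal hF), inferInstance, inferInstance,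
      inferInstance, (IsScalarTower.toAlgHom E (MvPolynomial (Fin 3) E ⧸ affineIdeal hF) _).comp
        (Ideal.Quotient.mkₐ E _), fun g ↦ ?_⟩
    rw [AlgHom.comp_apply, IsScalarTower.coe_toAlgHom', Ideal.Quotient.mkₐ_eq_mk,
      map_eq_zero_iff _ (IsFractionRing.injective _ _), Ideal.Quotient.eq_zero_iff_mem]
  let D := KaehlerDifferential.D E L
  have hφ0 : φ (X 0) = 1 := by
    have := (hφ _).mpr (X_sub_one_mem_affineIdeal hF)
    rwa [map_sub, map_one, sub_eq_zero] at this
  have hD (g) : D (φ g) = φ (pderiv 1 g) • D (φ (X 1)) + φ (pderiv 2 g) • D (φ (X 2)) := by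
    induction g using MvPolynomial.induction_on with
    | C c =>
      have : φ (C c) = algebraMap E L c := φ.commutes c
      simp [this]
    | add p q hp hq => simp only [map_add, hp, hq]; module
    | mul_X p n hp =>
      rw [map_mul, Derivation.leibniz, hp, pderiv_mul, pderiv_mul]
      fin_cases n <;> simp [hφ0] <;> module
  have hF0 := (hφ F).mpr (self_mem_affineIdeal hF)
  have hrel : φ r * φ (pderiv 2 F) = φ s * φ (pderiv 1 F) := by
    have := congr(φ $hr)
    simp only [ruppert, map_add, map_sub, map_mul, hF0, map_zero] at this
    linear_combination - this
  -- The partial derivatives of the closedness equation, restricted to the curve.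
  have hrel' (i) : φ (pderiv i F) * (φ (pderiv 2 r) - φ (pderiv 1 s)) =
      φ (pderiv i r) * φ (pderiv 2 F) + φ r * φ (pderiv i (pderiv 2 F)) -
      φ (pderiv i s) * φ (pderiv 1 F) - φ s * φ (pderiv i (pderiv 1 F)) := by
    have := congr(φ (pderiv i $hr))
    simp only [ruppert, map_add, map_sub, map_mul, pderiv_mul, hF0, map_zero] at this
    linear_combination this
  have hdF := hD F
  rw [hF0, map_zero] at hdF
  -- By `hrel`, `(r, s)` is proportional to the gradient `(∂₁F, ∂₂F)`, which is nonzero on the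
  -- curve; the ratio `a` is the residue.
  obtain ⟨a, ha1, ha2⟩ : ∃ a, φ r = a * φ (pderiv 1 F) ∧ φ s = a * φ (pderiv 2 F) := by
    by_cases h1 : φ (pderiv 1 F) = 0
    · have h2 : φ (pderiv 2 F) ≠ 0 := fun h2 ↦ hd ⟨(hφ _).mp h1, (hφ _).mp h2⟩
      refine ⟨φ s / φ (pderiv 2 F), ?_, by field_simp⟩
      rw [h1, mul_zero] at hrel ⊢
      exact (mul_eq_zero.mp hrel).resolve_right h2
    · refine ⟨φ r / φ (pderiv 1 F), by field_simp, ?_⟩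
      field_simp
      rw [hrel]
  -- Compute `dr` or `ds` both from `r = a ∂₁F`, `s = a ∂₂F` and from `hD`. With `hrel'` and `dF =
  -- 0` on the curve, the difference is `da` times a nonzero partial derivative.
  have hda : D a = 0 := by
    have h1 := hD r
    have h2 := hD s
    rw [ha1, Derivation.leibniz, hD (pderiv 1 F)] at h1
    rw [ha2, Derivation.leibniz, hD (pderiv 2 F)] at h2
    have e1 := hrel' 1
    have e2 := hrel' 2
    rw [pderiv_comm 2 1 F] at h1
    rw [pderiv_comm 2 1 F] at e2
    simp only [ha1, ha2] at e1 e2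
    by_cases h : φ (pderiv 1 F) = 0
    · have h0 : φ (pderiv 2 F) ≠ 0 := fun h2 ↦ hd ⟨(hφ _).mp h, (hφ _).mp h2⟩
      have h3 : φ (pderiv 2 F) • φ (pderiv 2 F) • D a = 0 := by
        linear_combination (norm := module) φ (pderiv 2 F) • h2 -
          (φ (pderiv 2 s) - a * φ (pderiv 2 (pderiv 2 F))) • hdF - e2 • D (φ (X 1))
      simpa [h0] using h3
    · have h3 : φ (pderiv 1 F) • φ (pderiv 1 F) • D a = 0 := by
        linear_combination (norm := module) φ (pderiv 1 F) • h1 -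
          (φ (pderiv 1 r) - a * φ (pderiv 1 (pderiv 1 F))) • hdF + e1 • D (φ (X 2))
      simpa [h] using h3
  obtain ⟨c, hc⟩ : ∃ c : E, a = algebraMap E L c := by
    by_contra hc
    have htr : Transcendental E a := fun halg ↦ by
      obtain ⟨c, hc'⟩ := minpoly.mem_range_of_degree_eq_one E a
        (IsAlgClosed.degree_eq_one_of_irreducible E (minpoly.irreducible halg.isIntegral))
      exact hc ⟨c, hc'.symm⟩
    exact htr.kaehlerDifferential_D_ne_zero hda
  have hC : φ (C c) = a := by
    rw [hc]
    exact φ.commutes c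
  refine ⟨c, (hφ _).mp ?_, (hφ _).mp ?_⟩
  · rw [map_sub, map_mul, hC, ha1, sub_self]
  · rw [map_sub, map_mul, hC, ha2, sub_self]

/-- **Ruppert's criterion**: for an irreducible form over an algebraically closed field of
characteristic zero, the linear system has no nonzero solution. -/
lemma not_hasRuppertSolution [IsAlgClosed E] [CharZero E] (hF : F.IsHomogeneous (d + 1))
    (hirr : Irreducible F) : ¬ HasRuppertSolution F d := by
  rintro ⟨r, s, hr, hs, hX, hne, hrs⟩
  -- A line is treated apart, since it may be `T₀ = 0` itself: there `r` and `s` are constants and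
  -- `T₀ ∣ r T₁ + s T₂` forces both to vanish.
  rcases Nat.eq_zero_or_pos d with rfl | hd0
  · rw [← totalDegree_zero_iff_isHomogeneous, totalDegree_eq_zero_iff_eq_C] at hr hs
    obtain ⟨q, hq⟩ := hX
    rw [hr, hs] at hq
    have h1 := congr(eval ![0, 1, 0] $hq)
    have h2 := congr(eval ![0, 0, 1] $hq)
    simp at h1 h2
    exact hne ⟨by rw [hr, h1, C_0], by rw [hs, h2, C_0]⟩
  have hp := hirr.prime
  have hXF : ¬ F ∣ X 0 := fun h ↦ X_ne_zero (R := E) (0 : Fin 3)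
    (eq_zero_of_dvd_of_isHomogeneous hF (isHomogeneous_X E 0) (by omega) h)
  have hX0 {c : E} (hc : c ≠ 0) : ¬ X 0 ∣ C c * F := fun h0 ↦ by
    have h1 : X 0 ∣ F := ((isUnit_iff_ne_zero.mpr hc).map C).dvd_mul_left.mp h0
    exact hXF ((X_prime (R := E)).irreducible.dvd_symm hirr h1)
  have hzero {g : MvPolynomial (Fin 3) E} (hg : g.IsHomogeneous d)
      (h : g ∈ affineIdeal hF) : g = 0 :=
    eq_zero_of_dvd_of_isHomogeneous hF hg (by omega) (dvd_of_mem_affineIdeal hF hp hXF hg h)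
  have heuler := IsHomogeneous.euler hF
  rw [← map_natCast C] at heuler
  have hdF (i) : (pderiv i F).IsHomogeneous d := hF.pderiv
  have hd1 : ((d + 1 : ℕ) : E) ≠ 0 := Nat.cast_ne_zero.mpr (by omega)
  -- If `∂₁F` and `∂₂F` both vanished on the curve they would be zero by degree, and Euler's
  -- identity would give `T₀ ∣ (d + 1) F`.
  obtain ⟨c, hc1, hc2⟩ := exists_residue hF hp hXF hrs fun h ↦ hX0 hd1 ⟨pderiv 0 F, by
    rw [← heuler, hzero (hdF 1) h.1, hzero (hdF 2) h.2]; ring⟩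
  have hh (i) : (C c * pderiv i F).IsHomogeneous d := by
    simpa using (isHomogeneous_C (Fin 3) c).mul (hdF i)
  have h1 := sub_eq_zero.mp (hzero (hr.sub (hh 1)) hc1)
  have h2 := sub_eq_zero.mp (hzero (hs.sub (hh 2)) hc2)
  obtain ⟨q, hq⟩ := hX
  -- Here `T₁ r + T₂ s = c ((d + 1) F - T₀ ∂₀F)` is divisible by `T₀`, while `F` is not.
  have hc : c = 0 := by
    by_contra hc
    refine hX0 (mul_ne_zero hc hd1) ⟨q + C c * pderiv 0 F, ?_⟩
    rw [C_mul, mul_assoc, ← heuler, mul_add (X 0), ← hq, h1, h2]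
    ring
  exact hne ⟨by rw [h1, hc, C_0, zero_mul], by rw [h2, hc, C_0, zero_mul]⟩

end

end

end PlaneCurve

/-! ### The linear system in matrix form. -/

/-- A matrix with independent columns has a nonzero maximal minor. -/
lemma Matrix.exists_det_submatrix_ne_zero {ι κ K : Type*} [Field K] [Fintype κ] [DecidableEq κ]
    (M : Matrix ι κ K) (hM : ∀ v, M.mulVec v = 0 → v = 0) :
    ∃ ρ : κ → ι, (M.submatrix ρ id).det ≠ 0 := by
  have htop : Submodule.span K (Set.range M.row) = ⊤ := by
    by_contra hne
    obtain ⟨φ, hφ0, hφ⟩ := Submodule.exists_le_ker_of_lt_top _ (lt_top_iff_ne_top.mpr hne)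
    have hdot (x : κ → K) : φ x = x ⬝ᵥ fun c ↦ φ (Pi.single c 1) := by
      conv_lhs => rw [pi_eq_sum_univ' x, map_sum]
      exact Finset.sum_congr rfl fun c _ ↦ by rw [map_smul, smul_eq_mul]
    have h0 := hM (fun c ↦ φ (Pi.single c 1)) (funext fun n ↦ by
      have := hφ (Submodule.subset_span ⟨n, rfl⟩)
      rw [LinearMap.mem_ker, hdot] at this
      exact this)
    exact hφ0 (LinearMap.ext fun x ↦ by rw [hdot, h0]; simp)
  obtain ⟨κ', a, -, hspan, hli⟩ := exists_linearIndependent' K M.row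
  let b := Module.Basis.mk hli (by rw [hspan, htop])
  let e := (Pi.basisFun K κ).indexEquiv b
  refine ⟨a ∘ e, fun h ↦ ?_⟩
  have hli' := hli.comp e e.injective
  have hu : IsUnit (M.submatrix (a ∘ e) id) := Matrix.linearIndependent_rows_iff_isUnit.mp hli'
  exact ((Matrix.isUnit_iff_isUnit_det _).mp hu).ne_zero h

/-- The absolute value of a determinant is at most the product of the sums of the absolute values
of the entries of the columns. -/
lemma AbsoluteValue.map_det_le {K κ : Type*} [CommRing K] [Nontrivial K] [Fintype κ] [DecidableEq κ]
    (w : AbsoluteValue K ℝ) (M : Matrix κ κ K) : w M.det ≤ ∏ c, ∑ n, w (M n c) := by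
  rw [Matrix.det_apply]
  refine (w.sum_le _ _).trans ?_
  rw [Finset.prod_univ_sum, Fintype.piFinset_univ]
  have h1 (σ : Equiv.Perm κ) : w (Equiv.Perm.sign σ • ∏ i, M (σ i) i) = ∏ i, w (M (σ i) i) := by
    rw [← map_prod]
    rcases Int.units_eq_one_or (Equiv.Perm.sign σ) with h | h <;> simp [h]
  simp_rw [h1]
  -- Expanding the product of column sums gives one term for every map `κ → κ`; the permutations
  -- contribute only some of these nonnegative terms.
  have h2 := Finset.sum_map (Finset.univ : Finset (Equiv.Perm κ))
    ⟨fun σ : Equiv.Perm κ ↦ (σ : κ → κ), DFunLike.coe_injective⟩ (fun f ↦ ∏ i, w (M (f i) i))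
  refine h2.symm.trans_le (Finset.sum_le_sum_of_subset_of_nonneg (Finset.subset_univ _)
    fun f _ _ ↦ Finset.prod_nonneg fun i _ ↦ w.nonneg _)

namespace PlaneCurve

open MvPolynomial

noncomputable section

/-- The index type of the unknowns of the linear system attached to a form of degree `d + 1`. -/
abbrev ColIndex (d : ℕ) : Type :=
  {c : Fin 3 × (Fin 3 →₀ ℕ) // c.2 0 + c.2 1 + c.2 2 + 1 = d ∧ (c.1 = 0 → c.2 0 = 0)}

/-- An enumeration of the unknowns by the points of a square other than a corner. -/
def ColIndex.toSquare {d : ℕ} (c : ColIndex d) : Fin (d + 1) × Fin (d + 1) :=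
  -- The three kinds of unknowns go to the antidiagonal, to the region below it and to the region
  -- above it. The corner `(d, 0)` of the antidiagonal is missed.
  ![(⟨c.1.2 1, by have := c.2.1; omega⟩, ⟨d - c.1.2 1, by omega⟩),
    (⟨c.1.2 1, by have := c.2.1; omega⟩, ⟨c.1.2 2, by have := c.2.1; omega⟩),
    (⟨d - c.1.2 1, by omega⟩, ⟨d - c.1.2 2, by omega⟩)] c.1.1

lemma ColIndex.toSquare_injective (d : ℕ) : Function.Injective (ColIndex.toSquare (d := d)) := by
  rintro ⟨⟨i, m⟩, hm, hi⟩ ⟨⟨j, n⟩, hn, hj⟩ h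
  have hext (h0 : m 0 = n 0) (h1 : m 1 = n 1) (h2 : m 2 = n 2) : m = n := by
    ext k; fin_cases k <;> assumption
  fin_cases i <;> fin_cases j <;>
    simp [toSquare, Prod.ext_iff, Fin.ext_iff] at h hm hn hi hj <;>
    first
    | exact Subtype.ext (Prod.ext rfl (hext (by omega) (by omega) (by omega)))
    | omega

lemma ColIndex.toSquare_ne {d : ℕ} (c : ColIndex d) : c.toSquare ≠ (Fin.last d, 0) := by
  obtain ⟨⟨i, m⟩, hm, hi⟩ := c
  intro h
  fin_cases i <;> simp [toSquare, Prod.ext_iff, Fin.ext_iff] at h hm hi <;> omega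

instance (d : ℕ) : Fintype (ColIndex d) := Fintype.ofInjective _ (ColIndex.toSquare_injective d)

/-- The missed corner is the source of the `-1` in `δ² - 1`. -/
lemma ColIndex.card_le (d : ℕ) : Fintype.card (ColIndex d) ≤ (d + 1) ^ 2 - 1 := by
  have h := Fintype.card_le_of_injective
    (fun c : ColIndex d ↦ (⟨c.toSquare, c.toSquare_ne⟩ :
      {x : Fin (d + 1) × Fin (d + 1) // x ≠ (Fin.last d, 0)}))
    fun c c' h ↦ ColIndex.toSquare_injective d (congr_arg Subtype.val h)
  rw [Fintype.card_subtype_compl, Fintype.card_subtype_eq, Fintype.card_prod, Fintype.card_fin,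
    ← sq] at h
  exact h

section

variable {R : Type*} [CommRing R] {d : ℕ}

variable (R) in
/-- The first components of the basic solutions of `T₀ ∣ T₁ r + T₂ s`. -/
def colFst (c : ColIndex d) : MvPolynomial (Fin 3) R :=
  ![X 2, X 0, 0] c.1.1 * monomial c.1.2 1

variable (R) in
/-- The second components of the basic solutions of `T₀ ∣ T₁ r + T₂ s`. -/
def colSnd (c : ColIndex d) : MvPolynomial (Fin 3) R :=
  ![-X 1, 0, X 0] c.1.1 * monomial c.1.2 1

/-- The matrix of the linear system attached to a form of degree `d + 1`. -/
def ruppertMatrix (d : ℕ) (F : MvPolynomial (Fin 3) R) : Matrix (Fin 3 →₀ ℕ) (ColIndex d) R :=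
  .of fun n c ↦ coeff n (ruppert F (colFst R c) (colSnd R c))

/-- Evaluation of the unknowns. -/
def combFst (v : ColIndex d → R) : MvPolynomial (Fin 3) R := ∑ c, C (v c) * colFst R c

/-- Evaluation of the unknowns. -/
def combSnd (v : ColIndex d → R) : MvPolynomial (Fin 3) R := ∑ c, C (v c) * colSnd R c

lemma ruppert_sum {ι : Type*} (s : Finset ι) (F : MvPolynomial (Fin 3) R) (v : ι → R)
    (p q : ι → MvPolynomial (Fin 3) R) :
    ruppert F (∑ c ∈ s, C (v c) * p c) (∑ c ∈ s, C (v c) * q c) =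
      ∑ c ∈ s, C (v c) * ruppert F (p c) (q c) := by
  simp only [ruppert, map_sum, pderiv_C_mul, ← Finset.sum_sub_distrib, Finset.mul_sum,
    Finset.sum_mul, ← Finset.sum_add_distrib]
  exact Finset.sum_congr rfl fun c _ ↦ by ring

lemma ruppertMatrix_mulVec (F : MvPolynomial (Fin 3) R) (v : ColIndex d → R) (n : Fin 3 →₀ ℕ) :
    ((ruppertMatrix d F).mulVec v) n = coeff n (ruppert F (combFst v) (combSnd v)) := by
  rw [combFst, combSnd, ruppert_sum, coeff_sum]
  exact Finset.sum_congr rfl fun c _ ↦ by rw [coeff_C_mul, mul_comm]; rfl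

lemma map_ruppert {S : Type*} [CommRing S] (φ : R →+* S) (F r s : MvPolynomial (Fin 3) R) :
    map φ (ruppert F r s) = ruppert (map φ F) (map φ r) (map φ s) := by
  simp only [ruppert, map_add, map_sub, map_mul, pderiv_map]

lemma map_colFst {S : Type*} [CommRing S] (φ : R →+* S) (c : ColIndex d) :
    map φ (colFst R c) = colFst S c := by
  obtain ⟨⟨i, m⟩, hm⟩ := c
  fin_cases i <;> simp [colFst]

lemma map_colSnd {S : Type*} [CommRing S] (φ : R →+* S) (c : ColIndex d) :
    map φ (colSnd R c) = colSnd S c := by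
  obtain ⟨⟨i, m⟩, hm⟩ := c
  fin_cases i <;> simp [colSnd]

lemma ruppertMatrix_map {S : Type*} [CommRing S] (φ : R →+* S) (F : MvPolynomial (Fin 3) R) :
    ruppertMatrix d (map φ F) = (ruppertMatrix d F).map φ := by
  ext n c
  rw [Matrix.map_apply, ruppertMatrix, ruppertMatrix, Matrix.of_apply, Matrix.of_apply,
    ← coeff_map, map_ruppert, map_colFst, map_colSnd]

lemma ruppertMatrix_C_mul (a : R) (F : MvPolynomial (Fin 3) R) :
    ruppertMatrix d (C a * F) = a • ruppertMatrix d F := by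
  ext n c
  have : ruppert (C a * F) (colFst R c) (colSnd R c) =
      C a * ruppert F (colFst R c) (colSnd R c) := by
    simp only [ruppert, pderiv_C_mul]
    ring
  simp only [ruppertMatrix, Matrix.of_apply, Matrix.smul_apply, this, coeff_C_mul, smul_eq_mul]

lemma isHomogeneous_monomial_one {m : Fin 3 →₀ ℕ} {k : ℕ} (h : m 0 + m 1 + m 2 = k) :
    (monomial m (1 : R)).IsHomogeneous k :=
  isHomogeneous_monomial _ (by rw [Finsupp.degree_eq_sum, Fin.sum_univ_three, h])

lemma isHomogeneous_colFst (c : ColIndex d) : (colFst R c).IsHomogeneous d := by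
  obtain ⟨⟨i, m⟩, hm, hi⟩ := c
  have h1 := isHomogeneous_monomial_one (R := R) (m := m) rfl
  have h2 (j) := (isHomogeneous_X R j).mul h1
  simp only [add_comm 1, hm] at h2
  fin_cases i
  · exact h2 2
  · exact h2 0
  · simp [colFst, isHomogeneous_zero]

lemma isHomogeneous_colSnd (c : ColIndex d) : (colSnd R c).IsHomogeneous d := by
  obtain ⟨⟨i, m⟩, hm, hi⟩ := c
  have h1 := isHomogeneous_monomial_one (R := R) (m := m) rfl
  have h2 (j) := (isHomogeneous_X R j).mul h1
  simp only [add_comm 1, hm] at h2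
  fin_cases i
  · simpa [colSnd] using (h2 1).neg
  · simp [colSnd, isHomogeneous_zero]
  · exact h2 0

lemma isHomogeneous_combFst (v : ColIndex d → R) : (combFst v).IsHomogeneous d :=
  IsHomogeneous.sum _ _ _ fun c _ ↦ by
    simpa using (isHomogeneous_C (Fin 3) (v c)).mul (isHomogeneous_colFst c)

lemma isHomogeneous_combSnd (v : ColIndex d → R) : (combSnd v).IsHomogeneous d :=
  IsHomogeneous.sum _ _ _ fun c _ ↦ by
    simpa using (isHomogeneous_C (Fin 3) (v c)).mul (isHomogeneous_colSnd c)

lemma X_dvd_comb (v : ColIndex d → R) : X 0 ∣ X 1 * combFst v + X 2 * combSnd v := by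
  rw [combFst, combSnd, Finset.mul_sum, Finset.mul_sum, ← Finset.sum_add_distrib]
  refine Finset.dvd_sum fun ⟨⟨i, m⟩, hm, hi⟩ _ ↦ ?_
  fin_cases i
  · exact ⟨0, by simp [colFst, colSnd]; ring⟩
  · exact ⟨X 1 * C (v ⟨⟨1, m⟩, hm, hi⟩) * monomial m 1, by simp [colFst, colSnd]; ring⟩
  · exact ⟨X 2 * C (v ⟨⟨2, m⟩, hm, hi⟩) * monomial m 1, by simp [colFst, colSnd]; ring⟩

lemma coeff_X_mul_monomial_one (i : Fin 3) (m n : Fin 3 →₀ ℕ) :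
    coeff n (X i * monomial m (1 : R)) = if m + Finsupp.single i 1 = n then 1 else 0 := by
  rw [X, monomial_mul, coeff_monomial, mul_one, add_comm]

variable (v : ColIndex d → R) (m : Fin 3 →₀ ℕ)

lemma coeff_combFst (n : Fin 3 →₀ ℕ) :
    coeff n (combFst v) = ∑ c, v c * coeff n (colFst R c) := by
  simp only [combFst, coeff_sum, coeff_C_mul]

lemma coeff_combSnd (n : Fin 3 →₀ ℕ) :
    coeff n (combSnd v) = ∑ c, v c * coeff n (colSnd R c) := by
  simp only [combSnd, coeff_sum, coeff_C_mul]

lemma add_single_ne {m n : Fin 3 →₀ ℕ} {i : Fin 3} (h : m 0 = 0) (hi : i ≠ 0) :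
    m + Finsupp.single i 1 ≠ n + Finsupp.single 0 1 := fun he ↦ by
  have := DFunLike.congr_fun he 0
  simp [h, hi] at this

lemma coeff_combFst_one (hm : m 0 + m 1 + m 2 + 1 = d) :
    coeff (m + Finsupp.single 0 1) (combFst v) = v ⟨(1, m), hm, by simp⟩ := by
  rw [coeff_combFst, Finset.sum_eq_single ⟨(1, m), hm, by simp⟩ _ (by simp)]
  · simp [colFst, coeff_X_mul_monomial_one]
  · rintro ⟨⟨i, n⟩, hn, hi⟩ - hne
    fin_cases i
    · simp [colFst, coeff_X_mul_monomial_one, add_single_ne (hi rfl)]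
    · have : n ≠ m := fun h ↦ hne (by subst h; rfl)
      simp [colFst, coeff_X_mul_monomial_one, this]
    · simp [colFst]

lemma coeff_combSnd_two (hm : m 0 + m 1 + m 2 + 1 = d) :
    coeff (m + Finsupp.single 0 1) (combSnd v) = v ⟨(2, m), hm, by simp⟩ := by
  rw [coeff_combSnd, Finset.sum_eq_single ⟨(2, m), hm, by simp⟩ _ (by simp)]
  · simp [colSnd, coeff_X_mul_monomial_one]
  · rintro ⟨⟨i, n⟩, hn, hi⟩ - hne
    fin_cases i
    · simp [colSnd, coeff_X_mul_monomial_one, add_single_ne (hi rfl)]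
    · simp [colSnd]
    · have : n ≠ m := fun h ↦ hne (by subst h; rfl)
      simp [colSnd, coeff_X_mul_monomial_one, this]

lemma coeff_combFst_zero (hm : m 0 + m 1 + m 2 + 1 = d) (h0 : m 0 = 0) :
    coeff (m + Finsupp.single 2 1) (combFst v) = v ⟨(0, m), hm, fun _ ↦ h0⟩ := by
  rw [coeff_combFst, Finset.sum_eq_single ⟨(0, m), hm, fun _ ↦ h0⟩ _ (by simp)]
  · simp [colFst, coeff_X_mul_monomial_one]
  · rintro ⟨⟨i, n⟩, hn, hi⟩ - hne
    fin_cases i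
    · have : n ≠ m := fun h ↦ hne (by subst h; rfl)
      simp [colFst, coeff_X_mul_monomial_one, this]
    · simp [colFst, coeff_X_mul_monomial_one, (add_single_ne (n := n) h0 (i := 2) (by decide)).symm]
    · simp [colFst]

/-- Homogeneous solutions of `T₀ ∣ T₁ r + T₂ s` are determined by part of their coefficients. -/
lemma eq_zero_of_X_dvd {r s : MvPolynomial (Fin 3) R} (hr : r.IsHomogeneous d)
    (hs : s.IsHomogeneous d) (hX : X 0 ∣ X 1 * r + X 2 * s)
    (h1 : ∀ m : Fin 3 →₀ ℕ, m 0 + m 1 + m 2 + 1 = d → coeff (m + Finsupp.single 0 1) r = 0)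
    (h2 : ∀ m : Fin 3 →₀ ℕ, m 0 + m 1 + m 2 + 1 = d → coeff (m + Finsupp.single 0 1) s = 0)
    (h3 : ∀ m : Fin 3 →₀ ℕ, m 0 + m 1 + m 2 + 1 = d → m 0 = 0 →
      coeff (m + Finsupp.single 2 1) r = 0) : r = 0 ∧ s = 0 := by
  have hdeg {p : MvPolynomial (Fin 3) R} (hp : p.IsHomogeneous d) {n : Fin 3 →₀ ℕ}
      (h : coeff n p ≠ 0) : n 0 + n 1 + n 2 = d := by
    by_contra hn
    exact h (hp.coeff_eq_zero (by rwa [Finsupp.degree_eq_sum, Fin.sum_univ_three]))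
  have hrel (n : Fin 3 →₀ ℕ) (hn : n 0 = 0) :
      coeff n (X 1 * r) + coeff n (X 2 * s) = 0 := by
    obtain ⟨q, hq⟩ := hX
    rw [← coeff_add, hq, coeff_X_mul', if_neg (by simp [hn])]
  have hsplit (n : Fin 3 →₀ ℕ) (i : Fin 3) (hi : n i ≠ 0) :
      ∃ m : Fin 3 →₀ ℕ, n = m + Finsupp.single i 1 :=
    ⟨n - Finsupp.single i 1, (tsub_add_cancel_of_le
      (Finsupp.single_le_iff.mpr (Nat.one_le_iff_ne_zero.mpr hi))).symm⟩
  -- Modulo `T₀` the relation reads `T₁ r = -T₂ s`. Hence the part of `r` free of `T₀` is divisible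
  -- by `T₂`, and it determines the corresponding part of `s`.
  have hr0 : r = 0 := by
    ext n
    rw [coeff_zero]
    by_contra hn
    have hd := hdeg hr hn
    by_cases hn0 : n 0 = 0
    · by_cases hn2 : n 2 = 0
      · have := hrel (n + Finsupp.single 1 1) (by simp [hn0])
        rw [add_comm n, coeff_X_mul, coeff_X_mul', if_neg (by simp [hn2]), add_zero] at this
        exact hn this
      · obtain ⟨m, rfl⟩ := hsplit n 2 hn2
        simp at hd hn0
        exact hn (h3 m (by omega) hn0)
    · obtain ⟨m, rfl⟩ := hsplit n 0 hn0
      simp at hd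
      exact hn (h1 m (by omega))
  refine ⟨hr0, ?_⟩
  ext n
  rw [coeff_zero]
  by_contra hn
  have hd := hdeg hs hn
  by_cases hn0 : n 0 = 0
  · have := hrel (n + Finsupp.single 2 1) (by simp [hn0])
    rw [hr0, mul_zero, coeff_zero, zero_add, add_comm n, coeff_X_mul] at this
    exact hn this
  · obtain ⟨m, rfl⟩ := hsplit n 0 hn0
    simp at hd
    exact hn (h2 m (by omega))

end

section

variable {E : Type*} [Field E] {d : ℕ} {F : MvPolynomial (Fin 3) E}

lemma eq_zero_of_ruppertMatrix_mulVec_eq_zero (h : ¬ HasRuppertSolution F d) (v : ColIndex d → E)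
    (hv : (ruppertMatrix d F).mulVec v = 0) : v = 0 := by
  by_contra hne
  refine h ⟨combFst v, combSnd v, isHomogeneous_combFst v, isHomogeneous_combSnd v, X_dvd_comb v,
    fun ⟨h1, h2⟩ ↦ hne ?_, ?_⟩
  · funext ⟨⟨i, m⟩, hm, hi⟩
    fin_cases i
    · exact (coeff_combFst_zero v m hm (hi rfl)).symm.trans (by rw [h1, coeff_zero]; rfl)
    · exact (coeff_combFst_one v m hm).symm.trans (by rw [h1, coeff_zero]; rfl)
    · exact (coeff_combSnd_two v m hm).symm.trans (by rw [h2, coeff_zero]; rfl)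
  · ext n
    rw [← ruppertMatrix_mulVec, hv, coeff_zero]
    rfl

/-- A solution is recovered from its coordinates in the basic solutions, so it yields a nonzero
vector in the kernel of the whole matrix and of every square submatrix. -/
lemma HasRuppertSolution.det_submatrix_eq_zero (h : HasRuppertSolution F d)
    (ρ : ColIndex d → Fin 3 →₀ ℕ) : ((ruppertMatrix d F).submatrix ρ id).det = 0 := by
  obtain ⟨r, s, hr, hs, hX, hne, hrs⟩ := h
  let v : ColIndex d → E := fun c ↦ ![coeff (c.1.2 + Finsupp.single 2 1) r,
    coeff (c.1.2 + Finsupp.single 0 1) r, coeff (c.1.2 + Finsupp.single 0 1) s] c.1.1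
  have hv : r - combFst v = 0 ∧ s - combSnd v = 0 := by
    refine eq_zero_of_X_dvd (hr.sub (isHomogeneous_combFst v)) (hs.sub (isHomogeneous_combSnd v))
      ?_ (fun m hm ↦ ?_) (fun m hm ↦ ?_) (fun m hm h0 ↦ ?_)
    · convert dvd_sub hX (X_dvd_comb v) using 1
      ring
    · rw [coeff_sub, coeff_combFst_one v m hm]; exact sub_self _
    · rw [coeff_sub, coeff_combSnd_two v m hm]; exact sub_self _
    · rw [coeff_sub, coeff_combFst_zero v m hm h0]; exact sub_self _
  rw [sub_eq_zero, sub_eq_zero] at hv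
  refine Matrix.exists_mulVec_eq_zero_iff.mp ⟨v, fun h0 ↦ hne ?_, ?_⟩
  · rw [hv.1, hv.2, h0]
    simp [combFst, combSnd]
  · funext c
    have := ruppertMatrix_mulVec F v (ρ c)
    rwa [← hv.1, ← hv.2, hrs, coeff_zero] at this

end

end

end PlaneCurve

/-! ### Bounds for the minors at an absolute value. -/

namespace PlaneCurve

open MvPolynomial

noncomputable section

lemma sum_range_sum_range_add (a D : ℕ) :
    6 * ∑ k ∈ Finset.range (D + 1), ∑ j ∈ Finset.range (k + 1), (a + j) =
      (D + 1) * (D + 2) * (3 * a + D) := by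
  have h1 (k : ℕ) : 2 * ∑ j ∈ Finset.range (k + 1), (a + j) = (k + 1) * (2 * a + k) := by
    induction k with
    | zero => simp
    | succ k ih => rw [Finset.sum_range_succ, mul_add, ih]; ring
  induction D with
  | zero => simp; ring
  | succ D ih =>
    rw [Finset.sum_range_succ, mul_add, ih]
    linarith [h1 (D + 1)]

/-- A sum over exponents of monomials of degree `D`. -/
lemma sum_add_apply_le (s : Finset (Fin 3 →₀ ℕ)) {D : ℕ} (hs : ∀ n ∈ s, n 0 + n 1 + n 2 = D)
    (a : ℕ) (i : Fin 3) : 6 * ∑ n ∈ s, (a + n i) ≤ (D + 1) * (D + 2) * (3 * a + D) := by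
  classical
  rw [← sum_range_sum_range_add]
  refine Nat.mul_le_mul_left 6 ?_
  -- Exponents of degree `D` are parametrized by the triangle `j ≤ k ≤ D`, with `j = n i` and `k = n
  -- i + n (i + 1)`.
  let g : (Fin 3 →₀ ℕ) → (_ : ℕ) × ℕ := fun n ↦ ⟨n i + n (i + 1), n i⟩
  have hg : Set.InjOn g s := by
    intro m hm n hn h
    have h1 := hs m hm
    have h2 := hs n hn
    simp only [g, Sigma.mk.injEq, heq_eq_eq] at h
    ext k
    fin_cases i <;> simp at h <;> fin_cases k <;> simp <;> omega
  rw [Finset.sum_sigma', ← Finset.sum_image (f := fun x : (_ : ℕ) × ℕ ↦ a + x.2) (g := g) hg]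
  refine Finset.sum_le_sum_of_subset fun x hx ↦ ?_
  obtain ⟨n, hn, rfl⟩ := Finset.mem_image.mp hx
  have := hs n hn
  simp only [g, Finset.mem_sigma, Finset.mem_range]
  fin_cases i <;> simp <;> omega

section

variable {K κ : Type*} [Field K] [Fintype κ] (w : AbsoluteValue K ℝ) {ρ : κ → Fin 3 →₀ ℕ}

/-- The sum of the absolute values of the coefficients of a polynomial at given exponents. -/
def coeffSum (ρ : κ → Fin 3 →₀ ℕ) (p : MvPolynomial (Fin 3) K) : ℝ := ∑ c, w (coeff (ρ c) p)

lemma coeffSum_add_le (p q : MvPolynomial (Fin 3) K) :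
    coeffSum w ρ (p + q) ≤ coeffSum w ρ p + coeffSum w ρ q := by
  rw [coeffSum, coeffSum, coeffSum, ← Finset.sum_add_distrib]
  exact Finset.sum_le_sum fun c _ ↦ by rw [coeff_add]; exact w.add_le _ _

lemma coeffSum_neg (p : MvPolynomial (Fin 3) K) : coeffSum w ρ (-p) = coeffSum w ρ p := by
  simp [coeffSum]

lemma coeffSum_sum_le {ι : Type*} (s : Finset ι) (p : ι → MvPolynomial (Fin 3) K) :
    coeffSum w ρ (∑ n ∈ s, p n) ≤ ∑ n ∈ s, coeffSum w ρ (p n) := by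
  refine Finset.le_sum_of_subadditive _ ?_ (coeffSum_add_le w) s p
  simp [coeffSum]

lemma coeffSum_monomial_le (hρ : Function.Injective ρ) (n : Fin 3 →₀ ℕ) (a : K) :
    coeffSum w ρ (monomial n a) ≤ w a := by
  classical
  simp only [coeffSum, coeff_monomial]
  by_cases h : ∃ c, ρ c = n
  · obtain ⟨c, rfl⟩ := h
    rw [Finset.sum_eq_single c]
    · simp
    · intro b _ hb
      rw [if_neg fun h ↦ hb (hρ h).symm, map_zero]
    · simp
  · push Not at h
    rw [Finset.sum_eq_zero fun c _ ↦ by rw [if_neg (h c).symm, map_zero]]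
    exact w.nonneg a

lemma map_mul_natCast_le (a : K) (n : ℕ) : w (a * n) ≤ w a * n := by
  rw [map_mul]
  exact mul_le_mul_of_nonneg_left (w.apply_nat_le_self n) (w.nonneg a)

lemma coeffSum_ruppert_fst_le (hρ : Function.Injective ρ) (n b : Fin 3 →₀ ℕ) (a : K) :
    coeffSum w ρ (ruppert (monomial n a) (monomial b 1) 0) ≤ w a * (b 2 + n 2 : ℕ) := by
  have : ruppert (monomial n a) (monomial b 1) 0 =
      monomial (n + (b - Finsupp.single 2 1)) (a * (b 2 : K)) +
        -monomial (b + (n - Finsupp.single 2 1)) (a * (n 2 : K)) := by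
    simp [ruppert, pderiv_monomial, monomial_mul, sub_eq_add_neg]
  rw [this, Nat.cast_add, mul_add]
  refine (coeffSum_add_le w _ _).trans (add_le_add ?_ ?_)
  · exact (coeffSum_monomial_le w hρ _ _).trans (map_mul_natCast_le w _ _)
  · rw [coeffSum_neg]
    exact (coeffSum_monomial_le w hρ _ _).trans (map_mul_natCast_le w _ _)

lemma coeffSum_ruppert_snd_le (hρ : Function.Injective ρ) (n b : Fin 3 →₀ ℕ) (a : K) :
    coeffSum w ρ (ruppert (monomial n a) 0 (monomial b 1)) ≤ w a * (b 1 + n 1 : ℕ) := by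
  have : ruppert (monomial n a) 0 (monomial b 1) =
      -monomial (n + (b - Finsupp.single 1 1)) (a * (b 1 : K)) +
        monomial (b + (n - Finsupp.single 1 1)) (a * (n 1 : K)) := by
    simp [ruppert, pderiv_monomial, monomial_mul]
  rw [this, Nat.cast_add, mul_add]
  refine (coeffSum_add_le w _ _).trans (add_le_add ?_ ?_)
  · rw [coeffSum_neg]
    exact (coeffSum_monomial_le w hρ _ _).trans (map_mul_natCast_le w _ _)
  · exact (coeffSum_monomial_le w hρ _ _).trans (map_mul_natCast_le w _ _)

lemma ruppert_eq_sum (F r s : MvPolynomial (Fin 3) K) :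
    ruppert F r s = ∑ n ∈ F.support, ruppert (monomial n (coeff n F)) r s := by
  conv_lhs => rw [F.as_sum]
  simp only [ruppert, map_sum, Finset.mul_sum, Finset.sum_mul, ← Finset.sum_sub_distrib,
    ← Finset.sum_add_distrib]

/-- Euler's identity collapses the column of an unknown of the first kind: as `m 1 + m 2 + 2 = d +
1`, all terms except `T₀ ∂₀F` cancel. This keeps the column within the bound of the other two kinds.
-/
lemma ruppert_X_mul_monomial {d : ℕ} {F : MvPolynomial (Fin 3) K} (hF : F.IsHomogeneous (d + 1))
    {m : Fin 3 →₀ ℕ} (hm : m 0 + m 1 + m 2 + 1 = d) (h0 : m 0 = 0) :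
    ruppert F (X 2 * monomial m 1) (-X 1 * monomial m 1) =
      monomial m 1 * (X 0 * pderiv 0 F) := by
  have h1 := X_mul_pderiv_monomial (R := K) (i := (1 : Fin 3)) (m := m) (r := 1)
  have h2 := X_mul_pderiv_monomial (R := K) (i := (2 : Fin 3)) (m := m) (r := 1)
  have h3 := IsHomogeneous.euler hF
  have hd : ((d + 1 : ℕ) : MvPolynomial (Fin 3) K) = (m 1 : MvPolynomial (Fin 3) K) + m 2 + 2 := by
    rw [← hm, h0]
    push_cast
    ring
  rw [nsmul_eq_mul] at h1 h2
  rw [hd] at h3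
  simp only [ruppert, pderiv_mul, map_neg, pderiv_X_self]
  linear_combination F * h1 + F * h2 - monomial m 1 * h3

lemma coeffSum_X_mul_pderiv_le (hρ : Function.Injective ρ) (F : MvPolynomial (Fin 3) K)
    (m : Fin 3 →₀ ℕ) : coeffSum w ρ (monomial m 1 * (X 0 * pderiv 0 F)) ≤
      ∑ n ∈ F.support, w (coeff n F) * (0 + n 0 : ℕ) := by
  have : monomial m 1 * (X 0 * pderiv 0 F) =
      ∑ n ∈ F.support, monomial (m + n) (coeff n F * (n 0 : K)) := by
    conv_lhs => rw [F.as_sum]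
    rw [map_sum, Finset.mul_sum, Finset.mul_sum]
    refine Finset.sum_congr rfl fun n _ ↦ ?_
    rw [X_mul_pderiv_monomial, nsmul_eq_mul, ← map_natCast C, C_mul_monomial, monomial_mul, one_mul,
      mul_comm]
  rw [this]
  refine (coeffSum_sum_le w _ _).trans (Finset.sum_le_sum fun n _ ↦ ?_)
  rw [zero_add]
  exact (coeffSum_monomial_le w hρ _ _).trans (map_mul_natCast_le w _ _)

/-- The cube comes from `(D + 1)(D + 2)(3a + D) ≤ 6 D³` with `D = d + 1`, valid for `a = 0` and for
`a ≤ D - 2`. The latter range suffices because the columns of the second and third kinds carry a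
factor `T₀`. -/
lemma sum_mul_le {d : ℕ} {F : MvPolynomial (Fin 3) K} (hF : F.IsHomogeneous (d + 1)) {H : ℝ}
    (hH : ∀ n, w (coeff n F) ≤ H) {a : ℕ} (ha : a = 0 ∨ a + 1 ≤ d) (i : Fin 3) :
    ∑ n ∈ F.support, w (coeff n F) * (a + n i : ℕ) ≤ (d + 1 : ℕ) ^ 3 * H := by
  have hH0 : 0 ≤ H := (w.nonneg _).trans (hH 0)
  have h1 : ∑ n ∈ F.support, w (coeff n F) * (a + n i : ℕ) ≤
      H * (∑ n ∈ F.support, (a + n i) : ℕ) := by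
    rw [Nat.cast_sum, Finset.mul_sum]
    exact Finset.sum_le_sum fun n _ ↦ mul_le_mul_of_nonneg_right (hH n) (Nat.cast_nonneg _)
  have h2 := sum_add_apply_le F.support (D := d + 1) (fun n hn ↦ by
    by_contra h
    exact mem_support_iff.mp hn (hF.coeff_eq_zero
      (by rwa [Finsupp.degree_eq_sum, Fin.sum_univ_three]))) a i
  have h3 : ∑ n ∈ F.support, (a + n i) ≤ (d + 1) ^ 3 := by
    rcases ha with rfl | ha
    · refine Nat.le_of_mul_le_mul_left (h2.trans ?_) (by norm_num : 0 < 6)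
      ring_nf
      nlinarith
    · obtain ⟨e, rfl⟩ : ∃ e, d = a + 1 + e := ⟨_, (Nat.add_sub_cancel' ha).symm⟩
      refine Nat.le_of_mul_le_mul_left (h2.trans ?_) (by norm_num : 0 < 6)
      ring_nf
      nlinarith
  refine h1.trans ?_
  rw [mul_comm]
  exact mul_le_mul_of_nonneg_right (by exact_mod_cast h3) hH0

/-- The bound for the columns of the linear system. -/
lemma coeffSum_ruppert_col_le (hρ : Function.Injective ρ) {d : ℕ} {F : MvPolynomial (Fin 3) K}
    (hF : F.IsHomogeneous (d + 1)) {H : ℝ} (hH : ∀ n, w (coeff n F) ≤ H) (c : ColIndex d) :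
    coeffSum w ρ (ruppert F (colFst K c) (colSnd K c)) ≤ (d + 1 : ℕ) ^ 3 * H := by
  obtain ⟨⟨i, m⟩, hm, hi⟩ := c
  dsimp only at hm hi
  have hX : (X 0 * monomial m 1 : MvPolynomial (Fin 3) K) =
      monomial (Finsupp.single 0 1 + m) 1 := by
    rw [X, monomial_mul, one_mul]
  fin_cases i
  · refine Eq.trans_le ?_ ((coeffSum_X_mul_pderiv_le w hρ F m).trans
      (sum_mul_le w hF hH (.inl rfl) 0))
    rw [← ruppert_X_mul_monomial hF hm (hi rfl)]
    rfl
  · have h : ruppert F (colFst K ⟨(1, m), hm, hi⟩) (colSnd K ⟨(1, m), hm, hi⟩) =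
        ruppert F (monomial (Finsupp.single 0 1 + m) 1) 0 := by
      simp [colFst, colSnd, hX]
    refine Eq.trans_le (congr_arg _ h) ?_
    rw [ruppert_eq_sum]
    refine ((coeffSum_sum_le w _ _).trans (Finset.sum_le_sum fun n _ ↦
      coeffSum_ruppert_fst_le w hρ n _ _)).trans (sum_mul_le w hF hH (.inr ?_) 2)
    simp
    omega
  · have h : ruppert F (colFst K ⟨(2, m), hm, hi⟩) (colSnd K ⟨(2, m), hm, hi⟩) =
        ruppert F 0 (monomial (Finsupp.single 0 1 + m) 1) := by
      simp [colFst, colSnd, hX]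
    refine Eq.trans_le (congr_arg _ h) ?_
    rw [ruppert_eq_sum]
    refine ((coeffSum_sum_le w _ _).trans (Finset.sum_le_sum fun n _ ↦
      coeffSum_ruppert_snd_le w hρ n _ _)).trans (sum_mul_le w hF hH (.inr ?_) 1)
    simp
    omega

lemma map_det_ruppertMatrix_le {d : ℕ} {F : MvPolynomial (Fin 3) K}
    (hF : F.IsHomogeneous (d + 1)) {H : ℝ} (hH : ∀ n, w (coeff n F) ≤ H)
    (ρ : ColIndex d → Fin 3 →₀ ℕ) :
    w ((ruppertMatrix d F).submatrix ρ id).det ≤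
      ((d + 1 : ℕ) ^ 3 * H) ^ Fintype.card (ColIndex d) := by
  have hH0 : 0 ≤ H := (w.nonneg _).trans (hH 0)
  by_cases hρ : Function.Injective ρ
  · refine (w.map_det_le _).trans ?_
    rw [← Finset.card_univ, ← Finset.prod_const]
    exact Finset.prod_le_prod (fun _ _ ↦ Finset.sum_nonneg fun _ _ ↦ w.nonneg _)
      fun c _ ↦ coeffSum_ruppert_col_le w hρ hF hH c
  -- A repeated row makes the minor vanish; the column bounds need distinct exponents.
  · obtain ⟨c, c', h, hne⟩ := Function.not_injective_iff.mp hρ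
    rw [Matrix.det_zero_of_row_eq hne (funext fun _ ↦ by simp [h]), map_zero]
    positivity

end

end

end PlaneCurve

/-! ### The product formula and the conclusion. -/

namespace PlaneCurve

open MvPolynomial IsDedekindDomain

noncomputable section

lemma det_submatrix_ruppertMatrix_map {d : ℕ} (ρ : ColIndex d → Fin 3 →₀ ℕ) {R S : Type*} [CommRing R] [CommRing S] (φ : R →+* S)
    (F : MvPolynomial (Fin 3) R) :
    ((ruppertMatrix d (map φ F)).submatrix ρ id).det =
      φ ((ruppertMatrix d F).submatrix ρ id).det := by
  rw [ruppertMatrix_map, RingHom.map_det]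
  rfl

lemma coeff_le_iSup {K : Type*} [Field K] {f : MvPolynomial (Fin 3) K} {F : Type*} [FunLike F K ℝ] [MonoidWithZeroHomClass F K ℝ]
    [NonnegHomClass F K ℝ] (v : F) (n : Fin 3 →₀ ℕ) :
    v (coeff n f) ≤ ⨆ m : f.support, v (coeff m f) := by
  by_cases hn : n ∈ f.support
  · exact Finite.le_ciSup_of_le (⟨n, hn⟩ : f.support) le_rfl
  · rw [notMem_support_iff.mp hn, map_zero]
    exact Real.iSup_nonneg fun m ↦ apply_nonneg v _

variable {K : Type u} [Field K] [NumberField K]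

lemma apply_mul_absNorm_le_one (w : FinitePlace K) {x : 𝓞 K} (hx : x ∈ w.maximalIdeal.asIdeal) :
    w (x : K) * w.maximalIdeal.asIdeal.absNorm ≤ 1 := by
  rcases eq_or_ne x 0 with rfl | hx0
  · simp
  have hN : 1 < w.maximalIdeal.asIdeal.absNorm := HeightOneSpectrum.one_lt_absNorm _
  rw [← w.apply_mul_absNorm_pow_eq_one hx0]
  refine mul_le_mul_of_nonneg_left ?_ (apply_nonneg w _)
  have hne : multiplicity w.maximalIdeal.asIdeal (Ideal.span {x}) ≠ 0 :=
    multiplicity_ne_zero.mpr (Ideal.dvd_span_singleton.mpr hx)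
  exact_mod_cast le_self_pow₀ hN.le hne

/-- A form of the product formula: if the absolute values of `Δ` are bounded by powers of the
maximal absolute value of the `x i`, with a gain of `N(𝔭)` at the places in `S`, then `S` is
finite and the product of the `N(𝔭)` is bounded by the height of `x`. -/
lemma finite_and_finsum_log_absNorm_le {ι : Type*} [Finite ι] [Nonempty ι] {x : ι → K}
    (hx : ∀ i, x i ≠ 0) {Δ : K} (hΔ : Δ ≠ 0) {A : ℝ} (hA : 1 ≤ A) (N : ℕ)
    (S : Set (FinitePlace K))
    (hinf : ∀ v : InfinitePlace K, v Δ ≤ (A * ⨆ i, v (x i)) ^ N)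
    (hfin : ∀ w : FinitePlace K, w Δ ≤ (⨆ i, w (x i)) ^ N)
    (hS : ∀ w ∈ S, w Δ * w.maximalIdeal.asIdeal.absNorm ≤ (⨆ i, w (x i)) ^ N) :
    S.Finite ∧ ∑ᶠ w ∈ S, Real.log (w.maximalIdeal.asIdeal.absNorm) ≤
      N * (Module.finrank ℚ K * Real.log A + Height.logHeight x) := by
  classical
  have hx0 : x ≠ 0 := fun h ↦ hx (Classical.arbitrary ι) (by rw [h]; rfl)
  have hN1 (w : FinitePlace K) : (1 : ℝ) < w.maximalIdeal.asIdeal.absNorm :=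
    mod_cast HeightOneSpectrum.one_lt_absNorm _
  have hsupΔ : Function.HasFiniteMulSupport fun w : FinitePlace K ↦ w Δ :=
    FinitePlace.hasFiniteMulSupport hΔ
  have hsupx : Function.HasFiniteMulSupport fun w : FinitePlace K ↦ ⨆ i, w (x i) :=
    .iSup fun i ↦ FinitePlace.hasFiniteMulSupport (hx i)
  -- At almost all places both `Δ` and the maximum of the `x i` have absolute value `1`; there the
  -- gain `N(𝔭) > 1` is impossible.
  have hfinS : S.Finite := by
    refine (hsupΔ.union hsupx).subset fun w hw ↦ ?_
    by_contra h
    simp only [Set.mem_union, Function.mem_mulSupport, not_or, not_not] at h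
    have := hS w hw
    rw [h.1, h.2, one_pow, one_mul] at this
    exact (hN1 w).not_ge this
  refine ⟨hfinS, ?_⟩
  set q : FinitePlace K → ℝ := fun w ↦ if w ∈ S then w.maximalIdeal.asIdeal.absNorm else 1 with hq
  have hsupq : Function.HasFiniteMulSupport q := by
    refine hfinS.subset fun w hw ↦ ?_
    by_contra h
    exact hw (by simp [hq, h])
  have hle : (∏ᶠ w : FinitePlace K, w Δ) * ∏ᶠ w, q w ≤ (∏ᶠ w : FinitePlace K, ⨆ i, w (x i)) ^ N := by
    rw [← finprod_mul_distrib hsupΔ hsupq, finprod_pow hsupx]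
    refine finprod_le_finprod (hsupΔ.mul hsupq) (fun w ↦ ?_) (hsupx.pow N) fun w ↦ ?_
    · refine mul_nonneg (apply_nonneg w _) ?_
      simp only [hq]
      split_ifs <;> positivity
    · by_cases hw : w ∈ S
      · simpa [hq, hw] using hS w hw
      · simpa [hq, hw] using hfin w
  have hle' : ∏ v : InfinitePlace K, v Δ ^ v.mult ≤
      (A ^ Module.finrank ℚ K * ∏ v : InfinitePlace K, (⨆ i, v (x i)) ^ v.mult) ^ N := by
    rw [← InfinitePlace.sum_mult_eq, ← Finset.prod_pow_eq_pow_sum, ← Finset.prod_mul_distrib,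
      ← Finset.prod_pow]
    refine Finset.prod_le_prod (fun v _ ↦ by positivity) fun v _ ↦ ?_
    rw [← mul_pow, ← pow_mul, mul_comm v.mult, pow_mul]
    exact pow_le_pow_left₀ (apply_nonneg v _) (hinf v) _
  have hqprod : ∏ᶠ w, q w = ∏ w ∈ hfinS.toFinset, (w.maximalIdeal.asIdeal.absNorm : ℝ) := by
    rw [← finprod_mem_eq_finite_toFinset_prod, finprod_mem_def]
    exact finprod_congr fun w ↦ by simp [hq, Set.mulIndicator_apply]
  have hqpos : 0 < ∏ᶠ w, q w := by
    rw [hqprod]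
    exact Finset.prod_pos fun w _ ↦ one_pos.trans (hN1 w)
  -- By the product formula `Δ` contributes `1` over all places, so the product of the gains is
  -- bounded by the remaining local factors.
  have key : ∏ᶠ w, q w ≤ (A ^ Module.finrank ℚ K * Height.mulHeight x) ^ N := by
    calc ∏ᶠ w, q w = (∏ v : InfinitePlace K, v Δ ^ v.mult) *
          ((∏ᶠ w : FinitePlace K, w Δ) * ∏ᶠ w, q w) := by
            rw [← mul_assoc, prod_abs_eq_one hΔ, one_mul]
      _ ≤ (A ^ Module.finrank ℚ K * ∏ v : InfinitePlace K, (⨆ i, v (x i)) ^ v.mult) ^ N *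
          (∏ᶠ w : FinitePlace K, ⨆ i, w (x i)) ^ N :=
            mul_le_mul hle' hle (mul_nonneg (finprod_nonneg fun w ↦ apply_nonneg w _) hqpos.le)
              ((Finset.prod_nonneg fun v _ ↦ by positivity).trans hle')
      _ = _ := by rw [NumberField.mulHeight_eq hx0, ← mul_pow, mul_assoc]
  rw [finsum_mem_eq_finite_toFinset_sum _ hfinS,
    ← Real.log_prod (fun w _ ↦ (one_pos.trans (hN1 w)).ne'), ← hqprod]
  refine (Real.log_le_log hqpos key).trans_eq ?_
  rw [Real.log_pow, Real.log_mul (by positivity) (Height.mulHeight_pos x).ne', Real.log_pow]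
  rfl

/-- The bijection between finite places and maximal ideals. -/
def finitePlaceEquiv : FinitePlace K ≃ MaximalSpectrum (𝓞 K) :=
  FinitePlace.equivHeightOneSpectrum.trans
    (HeightOneSpectrum.equivMaximalSpectrum (RingOfIntegers.not_isField K))

section

variable {d : ℕ} {f : MvPolynomial (Fin 3) K} (ρ : ColIndex d → Fin 3 →₀ ℕ)

/-- The matrix is linear in the form, so the minor of `g = c f` is `c ^ N` times that of `f`, with
`N` the number of unknowns. Some coefficient of `g` is a unit at `w`, hence `|c|⁻¹` is at most the
maximum of the coefficients of `f`. -/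
lemma exists_finitePlace_det_ruppertMatrix_le (hf0 : f ≠ 0) (w : FinitePlace K) :
    ∃ (c : K) (g : MvPolynomial (Fin 3) (𝓞 K)), c ≠ 0 ∧
      map (algebraMap (𝓞 K) K) g = C c * f ∧
      map (Ideal.Quotient.mk w.maximalIdeal.asIdeal) g ≠ 0 ∧
      w ((ruppertMatrix d f).submatrix ρ id).det ≤
        (⨆ m : f.support, w (coeff m f)) ^ Fintype.card (ColIndex d) *
          w (((ruppertMatrix d g).submatrix ρ id).det : 𝓞 K) := by
  obtain ⟨c, g, hc, hg, hgp⟩ := MvPolynomial.exists_C_mul_eq_map (R := 𝓞 K)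
    w.maximalIdeal.asIdeal w.maximalIdeal.isPrime.ne_top hf0
  refine ⟨c, g, hc, hg, hgp, ?_⟩
  have hwc : 0 < w c := FinitePlace.pos_iff.mpr hc
  have hH : 1 ≤ w c * ⨆ m : f.support, w (coeff m f) := by
    obtain ⟨n, hn⟩ := MvPolynomial.ne_zero_iff.mp hgp
    rw [coeff_map, Ne, Ideal.Quotient.eq_zero_iff_mem] at hn
    have h1 : w (coeff n g : 𝓞 K) = 1 := by
      rw [← w.norm_embedding_eq]
      exact (FinitePlace.norm_eq_one_iff_notMem K _ _).mpr hn
    have h2 : ((coeff n g : 𝓞 K) : K) = c * coeff n f := by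
      rw [← coeff_C_mul, ← hg, coeff_map]
    rw [← h1, h2, map_mul]
    exact mul_le_mul_of_nonneg_left (coeff_le_iSup w n) hwc.le
  have hdet : ((((ruppertMatrix d g).submatrix ρ id).det : 𝓞 K) : K) =
      c ^ Fintype.card (ColIndex d) * ((ruppertMatrix d f).submatrix ρ id).det := by
    change algebraMap (𝓞 K) K _ = _
    rw [← det_submatrix_ruppertMatrix_map, hg, ruppertMatrix_C_mul, ← Matrix.det_smul]
    rfl
  rw [hdet, map_mul, map_pow, ← mul_assoc, ← mul_pow, mul_comm _ (w c)]
  exact le_mul_of_one_le_left (apply_nonneg w _) (one_le_pow₀ hH)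

end

variable {X : Scheme.{u}} {i : X ⟶ Plane K} {d : ℕ} {f : MvPolynomial (Fin 3) K}

lemma det_ruppertMatrix_mem_of_mem_badPrimes {hf : f.IsHomogeneous (d + 1)}
    (hX : IsCutOutBy i hf) (ρ : ColIndex d → Fin 3 →₀ ℕ) {p : MaximalSpectrum (𝓞 K)}
    (hp : p ∈ badPrimes i) {c : K} (hc : c ≠ 0) {g : MvPolynomial (Fin 3) (𝓞 K)}
    (hg : map (algebraMap (𝓞 K) K) g = C c * f)
    (hgp : map (Ideal.Quotient.mk p.asIdeal) g ≠ 0) :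
    ((ruppertMatrix d g).submatrix ρ id).det ∈ p.asIdeal := by
  obtain ⟨E, _, _, φ, hφ, hirr⟩ := hX.exists_not_irreducible hp hc hg hgp
  have hghom : g.IsHomogeneous (d + 1) := by
    intro n hn
    have h : coeff n (map (algebraMap (𝓞 K) K) g) ≠ 0 := by
      rw [coeff_map]
      exact (map_ne_zero_iff _ (FaithfulSMul.algebraMap_injective (𝓞 K) K)).mpr hn
    rw [hg, coeff_C_mul] at h
    exact hf (right_ne_zero_of_mul h)
  have hg0 : map φ g ≠ 0 := by
    obtain ⟨n, hn⟩ := MvPolynomial.ne_zero_iff.mp hgp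
    refine MvPolynomial.ne_zero_iff.mpr ⟨n, ?_⟩
    rw [coeff_map] at hn ⊢
    rwa [Ne, ← RingHom.mem_ker, hφ, ← Ideal.Quotient.eq_zero_iff_mem]
  rw [← hφ, RingHom.mem_ker, ← det_submatrix_ruppertMatrix_map]
  exact (HasRuppertSolution.of_not_irreducible (hghom.map φ) hg0 hirr).det_submatrix_eq_zero ρ

/-- The criterion needs an algebraically closed field, but the minors have entries in `K`, so their
nonvanishing descends. -/
lemma exists_det_ruppertMatrix_ne_zero (hf : f.IsHomogeneous (d + 1))
    (hirr : Irreducible (map (algebraMap K (AlgebraicClosure K)) f)) :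
    ∃ ρ : ColIndex d → Fin 3 →₀ ℕ, ((ruppertMatrix d f).submatrix ρ id).det ≠ 0 := by
  obtain ⟨ρ, hρ⟩ := Matrix.exists_det_submatrix_ne_zero _
    (eq_zero_of_ruppertMatrix_mulVec_eq_zero
      (not_hasRuppertSolution (hf.map (algebraMap K (AlgebraicClosure K))) hirr))
  rw [det_submatrix_ruppertMatrix_map] at hρ
  exact ⟨ρ, fun h ↦ hρ (by rw [h, map_zero])⟩

/-- The effective Bertini–Noether bound for plane curves. -/
theorem finite_badPrimes_and_sum_log_le (i : X ⟶ Plane K) {δ : ℕ} (hf : f.IsHomogeneous δ)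
    (hf0 : f ≠ 0) (hX : IsCutOutBy i hf)
    (hXint : GeometricallyIntegral (i ≫ Plane.toSpec K)) :
    (badPrimes i).Finite ∧
      1 / (Module.finrank ℚ K : ℝ) *
          ∑ᶠ p ∈ badPrimes i, Real.log (Nat.card (𝓞 K ⧸ p.asIdeal)) ≤
        ((δ : ℝ) ^ 2 - 1) * naiveHeight f +
          (3 * (δ : ℝ) ^ 2 - 3) * Real.log δ := by
  have hirr := IsCutOutBy.irreducible_map i hX hf0 hXint (AlgebraicClosure K)
  obtain _ | d := δ
  · exact absurd (isUnit_of_isHomogeneous_zero (hf.map _) hirr.ne_zero) hirr.not_isUnit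
  obtain ⟨ρ, hρ⟩ := exists_det_ruppertMatrix_ne_zero hf hirr
  set N := Fintype.card (ColIndex d) with hN
  have hne : Nonempty f.support := (MvPolynomial.support_nonempty.mpr hf0).to_subtype
  have hd : (1 : ℝ) ≤ (d + 1 : ℕ) := by simp
  obtain ⟨hfinite, hsum⟩ := finite_and_finsum_log_absNorm_le
    (x := fun m : f.support ↦ f.coeff m) (fun m ↦ MvPolynomial.mem_support_iff.mp m.2) hρ
    (one_le_pow₀ hd : (1 : ℝ) ≤ ((d + 1 : ℕ) : ℝ) ^ 3) N (finitePlaceEquiv ⁻¹' badPrimes i)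
    (fun v ↦ map_det_ruppertMatrix_le v.1 hf (coeff_le_iSup v) ρ)
    (fun w ↦ by
      obtain ⟨c, g, -, -, -, h⟩ := exists_finitePlace_det_ruppertMatrix_le ρ hf0 w
      refine h.trans (mul_le_of_le_one_right
        (pow_nonneg (Real.iSup_nonneg fun m ↦ apply_nonneg w _) _) ?_)
      rw [← w.norm_embedding_eq]
      exact FinitePlace.norm_le_one K _ _)
    (fun w hw ↦ by
      obtain ⟨c, g, hc, hg, hgp, h⟩ := exists_finitePlace_det_ruppertMatrix_le ρ hf0 w
      have hmem := det_ruppertMatrix_mem_of_mem_badPrimes hX ρ hw hc hg hgp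
      refine (mul_le_mul_of_nonneg_right h (Nat.cast_nonneg _)).trans ?_
      rw [mul_assoc]
      exact mul_le_of_le_one_right (pow_nonneg (Real.iSup_nonneg fun m ↦ apply_nonneg w _) _)
        (apply_mul_absNorm_le_one w hmem))
  have himage : finitePlaceEquiv '' (finitePlaceEquiv ⁻¹' badPrimes i) = badPrimes i :=
    Set.image_preimage_eq _ finitePlaceEquiv.surjective
  refine ⟨himage ▸ hfinite.image _, ?_⟩
  have hsum' : ∑ᶠ p ∈ badPrimes i, Real.log (Nat.card (𝓞 K ⧸ p.asIdeal)) =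
      ∑ᶠ w ∈ finitePlaceEquiv ⁻¹' badPrimes i,
        Real.log (w.maximalIdeal.asIdeal.absNorm) := by
    rw [← himage, finsum_mem_image finitePlaceEquiv.injective.injOn, himage]
    rfl
  have hr : (0 : ℝ) < Module.finrank ℚ K := mod_cast Module.finrank_pos
  have hlog : 0 ≤ Real.log (d + 1 : ℕ) := Real.log_nonneg hd
  have hh : 0 ≤ Height.logHeight fun m : f.support ↦ f.coeff m := Height.logHeight_nonneg _
  -- The number of unknowns may be replaced by `δ² - 1` because the height and `log δ` are
  -- nonnegative.
  have hNle : (N : ℝ) ≤ ((d + 1 : ℕ) : ℝ) ^ 2 - 1 := by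
    have h := ColIndex.card_le d
    rw [← hN] at h
    have h2 : N + 1 ≤ (d + 1) ^ 2 := by
      have : 1 ≤ (d + 1) ^ 2 := Nat.one_le_pow _ _ d.succ_pos
      omega
    rw [le_sub_iff_add_le]
    exact_mod_cast h2
  rw [hsum', naiveHeight, one_div, inv_mul_le_iff₀ hr]
  rw [Real.log_pow] at hsum
  calc _ ≤ _ := hsum
    _ ≤ (((d + 1 : ℕ) : ℝ) ^ 2 - 1) * (Module.finrank ℚ K * ((3 : ℕ) * Real.log (d + 1 : ℕ)) +
        Height.logHeight fun m : f.support ↦ f.coeff m) :=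
      mul_le_mul_of_nonneg_right hNle (by positivity)
    _ = _ := by
      field_simp
      push_cast
      ring

end

end PlaneCurve

theorem proposition4p2 {K : Type u} [Field K] [NumberField K]
    {X : Scheme.{u}} (i : X ⟶ PlaneCurve.Plane K)
    {δ : ℕ} {f : MvPolynomial (Fin 3) K} (hf : f.IsHomogeneous δ) (hf0 : f ≠ 0)
    (hX : PlaneCurve.IsCutOutBy i hf)
    (hXint : GeometricallyIntegral (i ≫ PlaneCurve.Plane.toSpec K)) :
    (PlaneCurve.badPrimes i).Finite ∧
      1 / (Module.finrank ℚ K : ℝ) *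
          ∑ᶠ p ∈ PlaneCurve.badPrimes i, Real.log (Nat.card (𝓞 K ⧸ p.asIdeal)) ≤
        ((δ : ℝ) ^ 2 - 1) * PlaneCurve.naiveHeight f +
          (3 * (δ : ℝ) ^ 2 - 3) * Real.log δ :=
  PlaneCurve.finite_badPrimes_and_sum_log_le i hf hf0 hX hXint
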